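/- Let $(W,S)$ be a finite Coxeter system with length function $\ell$. The (right) weak order on $W$ is given by $u\le v \iff \ell(u)+\ell(u^{-1}v)=\ell(v)$. For $I\subseteq S$ let $W_I$ be the subgroup generated by $I$, let $w_{\circ,I}$ be its longest element, and let $W^I=\{w\in W : \ell(ws)>\ell(w)\text{ for all } s\in I\}$. The facial weak order is the order on the set of all standard parabolic cosets $xW_I$ ($I\subseteq S$, $x\in W^I$) which is the reflexive and transitive closure of the relations (1) $xW_I \lessdot xW_{I\cup\{s\}}$ if $s\in S\setminus I$ and $x\in W^{I\cup\{s\}}$, (2) $xW_I \lessdot x\,w_{\circ,I}\,w_{\circ,I\setminus\{s\}}W_{I\setminus\{s\}}$ if $s\in I$, where $I\subseteq S$ and $x\in W^I$. An element $x$ of an ordered set $L$ is join-irreducible (respectively meet-irreducible) if it is not the least upper bound (respectively greatest lower bound) of any subset $Y\subseteq L\setminus\{x\}$, the empty set included. Let $I\subseteq S$ and $x\in W^I$. Then: (a) The coset $xW_I$ is join-irreducible in the facial weak order if and only if either $I=\varnothing$ and $x$ is join-irreducible in the weak order, or $I=\{s\}$ for some $s\in S$ and $xs$ is join-irreducible in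 the weak order. (b) The coset $xW_I$ is meet-irreducible in the facial weak order if and only if either $I=\varnothing$ or $I=\{s\}$ for some $s\in S$, and in both cases $x$ is meet-irreducible in the weak order. -/

import Mathlib

open scoped Pointwise

/-- `x` is join-irreducible: it is not a join (least upper bound) of any set `Y` of elements
different from `x`. The case `Y = ∅` shows that a minimum is never join-irreducible. -/
def IsJoinIrreducible {α : Type*} [Preorder α] (x : α) : Prop :=
  ¬ ∃ Y : Set α, x ∉ Y ∧ IsLUB Y x

/-- `x` is meet-irreducible: it is not a meet (greatest lower bound) of any set `Y` of elements
different from `x`. -/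
def IsMeetIrreducible {α : Type*} [Preorder α] (x : α) : Prop :=
  ¬ ∃ Y : Set α, x ∉ Y ∧ IsGLB Y x

namespace CoxeterSystem

/-- The set `S ⊆ W` of simple reflections. -/
def simpleSet {B W : Type*} [Group W] {M : CoxeterMatrix B} (cs : CoxeterSystem M W) : Set W :=
  Set.range cs.simple

/-- The group `W`, regarded as a poset under the right weak order. -/
def WeakOrder {B W : Type*} [Group W] {M : CoxeterMatrix B} (_cs : CoxeterSystem M W) : Type _ :=
  W

/-- The element `w` of `W`, as an element of the weak order. -/
def toWeak {B W : Type*} [Group W] {M : CoxeterMatrix B} (cs : CoxeterSystem M W) (w : W) :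
    cs.WeakOrder := w

/-- The right weak order: `u ≤ v` iff `ℓ(u) + ℓ(u⁻¹ v) = ℓ(v)`. -/
instance instPartialOrderWeakOrder {B W : Type*} [Group W] {M : CoxeterMatrix B}
    (cs : CoxeterSystem M W) : PartialOrder cs.WeakOrder where
  le (u v : W) := cs.length u + cs.length (u⁻¹ * v) = cs.length v
  le_refl (u : W) := by
    change cs.length u + cs.length (u⁻¹ * u) = cs.length u
    simp
  le_trans (u v w : W) := by
    intro (h1 : cs.length u + cs.length (u⁻¹ * v) = cs.length v)
      (h2 : cs.length v + cs.length (v⁻¹ * w) = cs.length w)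
    change cs.length u + cs.length (u⁻¹ * w) = cs.length w
    have h3 := cs.length_mul_le (u⁻¹ * v) (v⁻¹ * w)
    have h4 := cs.length_mul_le u (u⁻¹ * w)
    have e3 : u⁻¹ * v * (v⁻¹ * w) = u⁻¹ * w := by group
    have e4 : u * (u⁻¹ * w) = w := by group
    rw [e3] at h3
    rw [e4] at h4
    omega
  le_antisymm (u v : W) := by
    intro (h1 : cs.length u + cs.length (u⁻¹ * v) = cs.length v)
      (h2 : cs.length v + cs.length (v⁻¹ * u) = cs.length u)
    have h3 : cs.length (u⁻¹ * v) = 0 := by omega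
    have h4 : u⁻¹ * v = 1 := cs.length_eq_zero_iff.mp h3
    exact (inv_mul_eq_one (G := W)).mp h4

/-- `W^I`: the elements of `W` without right descents in `I`. For `I ⊆ S` these are the minimal
length representatives of the cosets of `W_I`. -/
def minReps {B W : Type*} [Group W] {M : CoxeterMatrix B} (cs : CoxeterSystem M W) (I : Set W) :
    Set W :=
  {w | ∀ s ∈ I, cs.length w < cs.length (w * s)}

theorem exists_longest {B W : Type*} [Group W] [Finite W] {M : CoxeterMatrix B}
    (cs : CoxeterSystem M W) (I : Set W) :
    ∃ w ∈ Subgroup.closure I, ∀ v ∈ Subgroup.closure I, cs.length v ≤ cs.length w :=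
  Set.exists_max_image (Subgroup.closure I : Set W) cs.length (Set.toFinite _)
    ⟨1, Subgroup.one_mem _⟩

/-- The longest element `w_{∘,I}` of the standard parabolic subgroup `W_I` of a finite Coxeter
group (`W_I` is the subgroup generated by `I`). -/
noncomputable def longest {B W : Type*} [Group W] [Finite W] {M : CoxeterMatrix B}
    (cs : CoxeterSystem M W) (I : Set W) : W :=
  Classical.choose (cs.exists_longest I)

/-- The Coxeter complex: all standard parabolic cosets `x W_I`, with `I ⊆ S` and `x ∈ W`,
as subsets of `W`. -/
def Complex {B W : Type*} [Group W] {M : CoxeterMatrix B} (cs : CoxeterSystem M W) : Type _ :=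
  {C : Set W // ∃ I ⊆ cs.simpleSet, ∃ x : W, C = x • (Subgroup.closure I : Set W)}

/-- The standard parabolic coset `x W_I`. -/
def coset {B W : Type*} [Group W] {M : CoxeterMatrix B} (cs : CoxeterSystem M W)
    (x : W) (I : Set W) (hI : I ⊆ cs.simpleSet) : cs.Complex :=
  ⟨x • (Subgroup.closure I : Set W), I, hI, x, rfl⟩

/-- The two types of relations which generate the facial weak order, for `I ⊆ S`, `x ∈ W^I`:
* `x W_I ⋖ x W_{I ∪ {s}}` if `s ∈ S ∖ I` and `x ∈ W^{I ∪ {s}}`;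
* `x W_I ⋖ x w_{∘,I} w_{∘,I ∖ {s}} W_{I ∖ {s}}` if `s ∈ I`. -/
inductive FacialStep {B W : Type*} [Group W] [Finite W] {M : CoxeterMatrix B}
    (cs : CoxeterSystem M W) : cs.Complex → cs.Complex → Prop
  | up (I : Set W) (hI : I ⊆ cs.simpleSet) (x : W) (hx : x ∈ cs.minReps I)
      (s : W) (hs : s ∈ cs.simpleSet) (hsI : s ∉ I) (hxs : x ∈ cs.minReps (insert s I)) :
      FacialStep cs (cs.coset x I hI) (cs.coset x (insert s I) (Set.insert_subset hs hI))
  | down (I : Set W) (hI : I ⊆ cs.simpleSet) (x : W) (hx : x ∈ cs.minReps I)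
      (s : W) (hs : s ∈ I) :
      FacialStep cs (cs.coset x I hI)
        (cs.coset (x * cs.longest I * cs.longest (I \ {s})) (I \ {s})
          (Set.sdiff_subset.trans hI))

/-- The facial weak order on the Coxeter complex: the reflexive and transitive closure of the
two types of relations above. -/
instance instPreorderComplex {B W : Type*} [Group W] [Finite W] {M : CoxeterMatrix B}
    (cs : CoxeterSystem M W) : Preorder cs.Complex where
  le := Relation.ReflTransGen cs.FacialStep
  le_refl _ := Relation.ReflTransGen.refl
  le_trans _ _ _ := Relation.ReflTransGen.trans

end CoxeterSystem

/-! A coset C has a minimum `x` and a maximum `x * longest I`. The facial weak order turns out to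
compare minima and maxima separately in the weak order (`coset_le_iff`), so cosets behave like
intervals of the weak order.

The steps entering C correspond to right descents r of its maximum m: for r in I the predecessor is
the face of C with minimum x and type I without r; for r outside I it is the coset of type I ∪ {r}
with maximum m. If m has two descents, C is the join of the two predecessors; with none, C is least;
with exactly one, everything strictly below C lies below a single predecessor. Hence C is
join-irreducible iff m has a unique right descent (`isJoinIrreducible_coset_iff_existsUnique`). The
weak order obeys the same criterion. All of I consists of descents of m, so uniqueness forces I to
be empty or a singleton {s}, and m is then x or xs. Left multiplication by the longest element of W
reverses both orders and exchanges minima with maxima, which gives the meet statement.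

Everything rests on one fact: inversion sets satisfy a cocycle identity mod 2
(`length_mul_lt_mul_iff`). It yields strong exchange, parabolic factorization, the properties of
longest elements, and the description of the weak order by containment of inversions. -/

namespace CoxeterSystem

variable {B W : Type*} [Group W] {M : CoxeterMatrix B} (cs : CoxeterSystem M W)

/-! ### The parity of the number of occurrences of a reflection in an inversion sequence -/

open Classical in
/-- The action of a simple reflection on `W × ZMod 2`, conjugating the first component and
recording in the second one whether it equals the simple reflection. -/
noncomputable def paritySimple (i : B) : Equiv.Perm (W × ZMod 2) :=
  Function.Involutive.toPerm
    (fun p => (cs.simple i * p.1 * cs.simple i, p.2 + if p.1 = cs.simple i then 1 else 0)) (by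
      rintro ⟨t, e⟩
      have h : cs.simple i * t * cs.simple i = cs.simple i ↔ t = cs.simple i := by
        rw [mul_eq_right, ← cs.inv_simple i, inv_mul_eq_one, cs.inv_simple, eq_comm]
      simp only [h, Prod.mk.injEq]
      refine ⟨by simp [mul_assoc], ?_⟩
      split_ifs
      · rw [add_assoc, CharTwo.add_self_eq_zero, add_zero]
      · simp)

open Classical in
theorem paritySimple_apply (i : B) (p : W × ZMod 2) :
    cs.paritySimple i p =
      (cs.simple i * p.1 * cs.simple i, p.2 + if p.1 = cs.simple i then 1 else 0) :=
  rfl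

-- Prepending a letter conjugates the current reflection once more and adds one term to the
-- inversion sequence, so the second component counts occurrences mod 2.
open Classical in
theorem prod_map_paritySimple (ω : List B) (t : W) (e : ZMod 2) :
    (ω.map cs.paritySimple).prod (t, e) =
      (cs.wordProd ω * t * (cs.wordProd ω)⁻¹, e + ((cs.rightInvSeq ω).count t : ZMod 2)) := by
  induction ω with
  | nil => simp
  | cons i ω ih =>
    have h : cs.wordProd ω * t * (cs.wordProd ω)⁻¹ = cs.simple i ↔
        (cs.wordProd ω)⁻¹ * cs.simple i * cs.wordProd ω = t := by
      constructor
      · intro h; rw [← h]; group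
      · intro h; rw [← h]; group
    rw [List.map_cons, List.prod_cons, Equiv.Perm.mul_apply, ih]
    rw [paritySimple_apply]
    ext1
    · simp [wordProd_cons, mul_assoc]
    · simp only [rightInvSeq, List.count_cons, h, beq_iff_eq]
      split_ifs <;> push_cast <;> ring

theorem prod_map_alternatingWord {G : Type*} [Monoid G] (f : B → G) (i j : B) (m : ℕ) :
    ((alternatingWord i j (2 * m)).map f).prod = (f i * f j) ^ m := by
  induction m with
  | zero => simp [alternatingWord]
  | succ m ih =>
    rw [show 2 * (m + 1) = 2 * m + 1 + 1 by ring, alternatingWord_succ, alternatingWord_succ]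
    simp [ih, pow_succ]

theorem wordProd_alternatingWord_add (i j : B) (k : ℕ) :
    cs.wordProd (alternatingWord i j (2 * (k + M i j) + 1)) =
      cs.wordProd (alternatingWord i j (2 * k + 1)) := by
  rw [prod_alternatingWord_eq_mul_pow, prod_alternatingWord_eq_mul_pow]
  have h1 : (2 * (k + M i j) + 1) / 2 = k + M i j := by omega
  have h2 : (2 * k + 1) / 2 = k := by omega
  have h3 : ¬ Even (2 * (k + M i j) + 1) := by simp
  have h4 : ¬ Even (2 * k + 1) := by simp
  rw [h1, h2, if_neg h3, if_neg h4, pow_add]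
  simp

-- The inversion sequence of a braid relator is its first half written twice: its entries are
-- alternating words of odd length, whose products are periodic.
open Classical in
theorem even_count_leftInvSeq_alternatingWord (i j : B) (t : W) :
    Even ((cs.leftInvSeq (alternatingWord i j (2 * M i j))).count t) := by
  set l := cs.leftInvSeq (alternatingWord i j (2 * M i j)) with hl
  have hlen : l.length = 2 * M i j := by simp [hl]
  have h : l.take (M i j) = l.drop (M i j) := by
    apply List.ext_getElem
    · simp [hlen]; omega
    · intro k h1 h2
      rw [List.length_take] at h1
      rw [List.getElem_take, List.getElem_drop]
      simp only [hl]
      rw [getElem_leftInvSeq_alternatingWord _ _ _ _ _ (by omega),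
        getElem_leftInvSeq_alternatingWord _ _ _ _ _ (by omega), add_comm (M i j) k,
        M.symmetric i j, wordProd_alternatingWord_add]
  rw [← List.take_append_drop (M i j) l, List.count_append, h]
  exact ⟨_, rfl⟩

theorem reverse_alternatingWord (i j : B) (m : ℕ) :
    (alternatingWord i j (2 * m)).reverse = alternatingWord j i (2 * m) := by
  apply List.ext_getElem
  · simp
  · intro k h1 h2
    simp only [List.length_reverse, length_alternatingWord] at h1
    rw [List.getElem_reverse, getElem_alternatingWord _ _ _ _ (by simp; omega),
      getElem_alternatingWord _ _ _ _ h1]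
    simp only [length_alternatingWord]
    by_cases hk : Even k
    · have h3 : ¬ Even (2 * m + (2 * m - 1 - k)) := by grind
      have h4 : Even (2 * m + k) := by grind
      rw [if_neg h3, if_pos h4]
    · have h3 : Even (2 * m + (2 * m - 1 - k)) := by grind
      have h4 : ¬ Even (2 * m + k) := by grind
      rw [if_pos h3, if_neg h4]

/-- A relator conjugates trivially, and each reflection occurs in its inversion sequence an even
number of times; hence the parity depends on the group element, not on the word. -/
theorem isLiftable_paritySimple : M.IsLiftable cs.paritySimple := by
  classical
  intro i j
  rw [← prod_map_alternatingWord]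
  ext1 ⟨t, e⟩
  rw [prod_map_paritySimple, wordProd, prod_map_alternatingWord, simple_mul_simple_pow]
  have h : cs.rightInvSeq (alternatingWord i j (2 * M i j)) =
      (cs.leftInvSeq (alternatingWord j i (2 * M j i))).reverse := by
    rw [← rightInvSeq_reverse, reverse_alternatingWord, M.symmetric i j]
  rw [h, List.count_reverse, (ZMod.natCast_eq_zero_iff_even).2
    (cs.even_count_leftInvSeq_alternatingWord j i t)]
  simp

/-- The extension of `paritySimple` to a homomorphism. -/
noncomputable def parityHom : W →* Equiv.Perm (W × ZMod 2) :=
  cs.lift ⟨cs.paritySimple, cs.isLiftable_paritySimple⟩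

/-- The parity of the number of occurrences of `t` in the right inversion sequence of any word
for `w`. -/
noncomputable def parity (w t : W) : ZMod 2 := (cs.parityHom w (t, 0)).2

theorem parityHom_wordProd (ω : List B) :
    cs.parityHom (cs.wordProd ω) = (ω.map cs.paritySimple).prod := by
  rw [wordProd, map_list_prod, List.map_map]
  congr 2
  ext1 i
  exact cs.lift_apply_simple cs.isLiftable_paritySimple i

open Classical in
theorem parity_wordProd (ω : List B) (t : W) :
    cs.parity (cs.wordProd ω) t = (cs.rightInvSeq ω).count t := by
  rw [parity, parityHom_wordProd, prod_map_paritySimple, zero_add]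

theorem parityHom_apply (w t : W) (e : ZMod 2) :
    cs.parityHom w (t, e) = (w * t * w⁻¹, e + cs.parity w t) := by
  classical
  obtain ⟨ω, rfl⟩ := cs.wordProd_surjective w
  rw [parityHom_wordProd, prod_map_paritySimple, parity_wordProd]

theorem parity_mul (u v t : W) :
    cs.parity (u * v) t = cs.parity v t + cs.parity u (v * t * v⁻¹) := by
  rw [parity, map_mul, Equiv.Perm.mul_apply, parityHom_apply, parityHom_apply, zero_add]

theorem parity_one (t : W) : cs.parity 1 t = 0 := by
  simp [parity]

theorem parity_simple_self (i : B) : cs.parity (cs.simple i) (cs.simple i) = 1 := by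
  classical
  rw [← wordProd_singleton, parity_wordProd]
  simp

/-- For t = u s u⁻¹ the cocycle identity makes the contributions of u and u⁻¹ cancel, leaving that
of s. -/
theorem parity_self {t : W} (ht : cs.IsReflection t) : cs.parity t t = 1 := by
  obtain ⟨u, i, rfl⟩ := ht
  have h := cs.parity_mul u u⁻¹ (u * cs.simple i * u⁻¹)
  rw [mul_inv_cancel, parity_one] at h
  rw [mul_assoc u (cs.simple i) u⁻¹, parity_mul, parity_mul]
  simp only [mul_inv_rev, inv_inv, inv_simple, mul_assoc, inv_mul_cancel_left, inv_mul_cancel,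
    mul_one, simple_mul_simple_cancel_left, parity_simple_self] at h ⊢
  linear_combination -h

theorem isRightInversion_of_parity_eq_one {w t : W} (h : cs.parity w t = 1) :
    cs.length (w * t) < cs.length w := by
  classical
  obtain ⟨ω, hω, rfl⟩ := cs.exists_isReduced w
  rw [parity_wordProd] at h
  refine (cs.isRightInversion_of_mem_rightInvSeq hω (List.count_pos_iff.1 ?_)).2
  by_contra h0
  rw [Nat.eq_zero_of_not_pos h0] at h
  simp at h

/-- If the parity of t in w is 0, it is 1 in wt; then passing from wt to w shortens, so t is not an
inversion of w. -/
theorem length_mul_lt_iff_parity {w t : W} (ht : cs.IsReflection t) :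
    cs.length (w * t) < cs.length w ↔ cs.parity w t = 1 := by
  refine ⟨fun h => ?_, cs.isRightInversion_of_parity_eq_one⟩
  by_contra h1
  have h0 : cs.parity w t = 0 := by
    generalize cs.parity w t = z at h1 ⊢
    revert z; decide
  have h2 : cs.parity (w * t) t = 1 := by
    rw [parity_mul, cs.parity_self ht, mul_inv_cancel_right, h0, add_zero]
  have h3 := cs.isRightInversion_of_parity_eq_one h2
  rw [mul_assoc, ht.mul_self, mul_one] at h3
  omega

/-- The inversion set of a product is a symmetric difference, which is the cocycle identity read
through lengths. -/
theorem length_mul_lt_mul_iff {u v t : W} (ht : cs.IsReflection t) :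
    cs.length (u * v * t) < cs.length (u * v) ↔
      ¬ (cs.length (v * t) < cs.length v ↔
        cs.length (u * (v * t * v⁻¹)) < cs.length u) := by
  rw [cs.length_mul_lt_iff_parity ht, cs.length_mul_lt_iff_parity ht,
    cs.length_mul_lt_iff_parity (ht.conj v), parity_mul]
  generalize cs.parity v t = a
  generalize cs.parity u _ = b
  revert a b; decide

/-- The left-handed cocycle identity for inversions. -/
theorem length_lt_mul_iff {u v t : W} (ht : cs.IsReflection t) :
    cs.length (t * (u * v)) < cs.length (u * v) ↔
      ¬ (cs.length (t * u) < cs.length u ↔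
        cs.length (u⁻¹ * t * u * v) < cs.length v) := by
  have h := cs.length_mul_lt_mul_iff (u := v⁻¹) (v := u⁻¹) ht
  rw [← cs.length_inv (v⁻¹ * u⁻¹ * t), ← cs.length_inv (v⁻¹ * u⁻¹), ← cs.length_inv (u⁻¹ * t),
    cs.length_inv u, cs.length_inv v, ← cs.length_inv (v⁻¹ * _)] at h
  simpa [mul_assoc, ht.inv] using h

/-- The strong exchange property, for an arbitrary word. -/
theorem exists_eraseIdx_of_length_mul_lt {ω : List B} {t : W} (ht : cs.IsReflection t)
    (h : cs.length (cs.wordProd ω * t) < cs.length (cs.wordProd ω)) :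
    ∃ j < ω.length, cs.wordProd ω * t = cs.wordProd (ω.eraseIdx j) := by
  classical
  rw [cs.length_mul_lt_iff_parity ht, parity_wordProd] at h
  have hm : t ∈ cs.rightInvSeq ω := by
    refine List.count_pos_iff.1 ?_
    by_contra h0
    rw [Nat.eq_zero_of_not_pos h0] at h
    simp at h
  obtain ⟨j, hj, rfl⟩ := List.mem_iff_getElem.mp hm
  refine ⟨j, by simpa using hj, ?_⟩
  rw [← List.getD_eq_getElem _ 1 hj, wordProd_mul_getD_rightInvSeq]

/-! ### Standard parabolic subgroups -/

variable {I J : Set W} {s t u v w x y : W}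

theorem isReflection_of_mem (hs : s ∈ cs.simpleSet) : cs.IsReflection s := by
  obtain ⟨i, rfl⟩ := hs
  exact cs.isReflection_simple i

theorem mul_self_of_mem (hs : s ∈ cs.simpleSet) : s * s = 1 :=
  (cs.isReflection_of_mem hs).mul_self

theorem inv_of_mem (hs : s ∈ cs.simpleSet) : s⁻¹ = s :=
  (cs.isReflection_of_mem hs).inv

theorem mul_mul_self_of_mem (hs : s ∈ cs.simpleSet) (w : W) : w * s * s = w := by
  rw [mul_assoc, cs.mul_self_of_mem hs, mul_one]

theorem self_mul_mul_of_mem (hs : s ∈ cs.simpleSet) (w : W) : s * (s * w) = w := by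
  rw [← mul_assoc, cs.mul_self_of_mem hs, one_mul]

theorem length_of_mem (hs : s ∈ cs.simpleSet) : cs.length s = 1 := by
  obtain ⟨i, rfl⟩ := hs
  exact cs.length_simple i

theorem length_mul_of_mem (hs : s ∈ cs.simpleSet) (w : W) :
    cs.length (w * s) = cs.length w + 1 ∨ cs.length (w * s) + 1 = cs.length w := by
  obtain ⟨i, rfl⟩ := hs
  exact cs.length_mul_simple w i

theorem length_of_mem_mul (hs : s ∈ cs.simpleSet) (w : W) :
    cs.length (s * w) = cs.length w + 1 ∨ cs.length (s * w) + 1 = cs.length w := by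
  obtain ⟨i, rfl⟩ := hs
  exact cs.length_simple_mul w i

theorem exists_isReduced_of_mem_closure (hI : I ⊆ cs.simpleSet) (hw : w ∈ Subgroup.closure I) :
    ∃ ω, cs.IsReduced ω ∧ (∀ i ∈ ω, cs.simple i ∈ I) ∧ w = cs.wordProd ω := by
  have key : ∀ s ∈ I, ∀ v, (∃ ω, cs.IsReduced ω ∧ (∀ i ∈ ω, cs.simple i ∈ I) ∧
      v = cs.wordProd ω) → ∃ ω, cs.IsReduced ω ∧ (∀ i ∈ ω, cs.simple i ∈ I) ∧
      v * s = cs.wordProd ω := by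
    rintro s hs v ⟨ω, hω, hωI, rfl⟩
    obtain ⟨i, rfl⟩ := hI hs
    rcases cs.length_mul_simple (cs.wordProd ω) i with h | h
    · refine ⟨ω ++ [i], ?_, ?_, ?_⟩
      · rw [IsReduced, wordProd_append, wordProd_singleton, h, hω.eq]
        simp
      · intro j hj
        rcases List.mem_append.1 hj with hj | hj
        · exact hωI j hj
        · rwa [List.mem_singleton.1 hj]
      · rw [wordProd_append, wordProd_singleton]
    -- When s shortens, exchange deletes one letter, so the new reduced word still uses only letters
    -- from I.
    · obtain ⟨j, hj, hj'⟩ := cs.exists_eraseIdx_of_length_mul_lt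
        (cs.isReflection_simple i) (ω := ω) (by omega)
      refine ⟨ω.eraseIdx j, ?_, fun k hk => hωI k (List.mem_of_mem_eraseIdx hk), hj'⟩
      rw [IsReduced, ← hj', List.length_eraseIdx_of_lt hj, ← hω.eq]
      omega
  induction hw using Subgroup.closure_induction_right with
  | one => exact ⟨[], by simp [IsReduced], by simp, by simp⟩
  | mul_right v _ s hs ih => exact key s hs v ih
  | mul_inv_cancel v _ s hs ih => rw [cs.inv_of_mem (hI hs)]; exact key s hs v ih

theorem exists_mul_left_lt (hI : I ⊆ cs.simpleSet) (hw : w ∈ Subgroup.closure I) (h1 : w ≠ 1) :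
    ∃ s ∈ I, cs.length (s * w) < cs.length w := by
  obtain ⟨ω, hω, hωI, rfl⟩ := cs.exists_isReduced_of_mem_closure hI hw
  cases ω with
  | nil => simp at h1
  | cons i ω =>
    refine ⟨cs.simple i, hωI i (by simp), ?_⟩
    rw [hω.eq, wordProd_cons, simple_mul_simple_cancel_left]
    exact (cs.length_wordProd_le ω).trans_lt (by simp)

theorem exists_mul_right_lt (hI : I ⊆ cs.simpleSet) (hw : w ∈ Subgroup.closure I) (h1 : w ≠ 1) :
    ∃ s ∈ I, cs.length (w * s) < cs.length w := by
  obtain ⟨s, hs, h⟩ := cs.exists_mul_left_lt hI (inv_mem hw) (inv_ne_one.2 h1)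
  refine ⟨s, hs, ?_⟩
  rwa [← cs.length_inv, ← cs.length_inv w, mul_inv_rev, cs.inv_of_mem (hI hs)]

theorem mem_of_mem_closure (hI : I ⊆ cs.simpleSet) (hs : s ∈ cs.simpleSet)
    (h : s ∈ Subgroup.closure I) : s ∈ I := by
  have hl := cs.length_of_mem hs
  obtain ⟨r, hr, hlt⟩ := cs.exists_mul_left_lt hI h (by rintro rfl; simp at hl)
  have h1 : r * s = 1 := cs.length_eq_zero_iff.1 (by omega)
  rw [mul_eq_one_iff_eq_inv, cs.inv_of_mem hs] at h1
  rwa [← h1]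

theorem mem_closure_of_length_mul_lt (hI : I ⊆ cs.simpleSet) (hw : w ∈ Subgroup.closure I)
    (ht : cs.IsReflection t) (h : cs.length (w * t) < cs.length w) :
    t ∈ Subgroup.closure I := by
  obtain ⟨ω, hω, hωI, rfl⟩ := cs.exists_isReduced_of_mem_closure hI hw
  obtain ⟨j, hj, h'⟩ := cs.exists_eraseIdx_of_length_mul_lt ht h
  have hm : cs.wordProd (ω.eraseIdx j) ∈ Subgroup.closure I := by
    refine Subgroup.list_prod_mem _ fun a ha => ?_
    obtain ⟨k, hk, rfl⟩ := List.mem_map.1 ha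
    exact Subgroup.subset_closure (hωI k (List.mem_of_mem_eraseIdx hk))
  rw [← h'] at hm
  exact (Subgroup.mul_mem_cancel_left _ hw).1 hm

theorem mem_closure_of_length_mul_left_lt (hI : I ⊆ cs.simpleSet)
    (hw : w ∈ Subgroup.closure I) (ht : cs.IsReflection t)
    (h : cs.length (t * w) < cs.length w) : t ∈ Subgroup.closure I := by
  refine cs.mem_closure_of_length_mul_lt hI (inv_mem hw) ht ?_
  rwa [← cs.length_inv, mul_inv_rev, inv_inv, ht.inv, cs.length_inv w]

theorem mem_of_length_mul_lt (hI : I ⊆ cs.simpleSet) (hw : w ∈ Subgroup.closure I)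
    (hs : s ∈ cs.simpleSet) (h : cs.length (w * s) < cs.length w) : s ∈ I :=
  cs.mem_of_mem_closure hI hs
    (cs.mem_closure_of_length_mul_lt hI hw (cs.isReflection_of_mem hs) h)

theorem mem_of_length_mul_left_lt (hI : I ⊆ cs.simpleSet) (hw : w ∈ Subgroup.closure I)
    (hs : s ∈ cs.simpleSet) (h : cs.length (s * w) < cs.length w) : s ∈ I :=
  cs.mem_of_mem_closure hI hs
    (cs.mem_closure_of_length_mul_left_lt hI hw (cs.isReflection_of_mem hs) h)

theorem closure_induction_length (hI : I ⊆ cs.simpleSet) {P : W → Prop} (one : P 1)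
    (mul : ∀ u ∈ Subgroup.closure I, ∀ s ∈ I, cs.length (u * s) = cs.length u + 1 → P u →
      P (u * s)) (hw : w ∈ Subgroup.closure I) : P w := by
  induction hn : cs.length w using Nat.strong_induction_on generalizing w with
  | _ n ih =>
    by_cases h1 : w = 1
    · rwa [h1]
    obtain ⟨s, hs, hlt⟩ := cs.exists_mul_right_lt hI hw h1
    have hws := mul_mem hw (Subgroup.subset_closure hs)
    have h2 := cs.mul_mul_self_of_mem (hI hs) w
    have h := mul (w * s) hws s hs (by
      rw [h2]; rcases cs.length_mul_of_mem (hI hs) w with h | h <;> omega)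
      (ih _ (by omega) hws rfl)
    rwa [h2] at h

/-- If `x` is minimal in `x W_I` up to reflections of `W_I`, lengths add. -/
theorem length_mul_of_forall_reflection (hI : I ⊆ cs.simpleSet)
    (h : ∀ t ∈ Subgroup.closure I, cs.length x ≤ cs.length (x * t))
    (hu : u ∈ Subgroup.closure I) : cs.length (x * u) = cs.length x + cs.length u := by
  refine cs.closure_induction_length hI
    (P := fun u => cs.length (x * u) = cs.length x + cs.length u) (by simp) ?_ hu
  intro v hv s hs hl ih
  have hr := cs.isReflection_of_mem (hI hs)
  -- Since s lengthens v, it could shorten xv only if v s v⁻¹, a reflection in W_I, shortened x.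
  have h1 := cs.length_mul_lt_mul_iff (u := x) (v := v) hr
  have h2 := h (v * s * v⁻¹) (mul_mem (mul_mem hv (Subgroup.subset_closure hs)) (inv_mem hv))
  rw [← mul_assoc]
  rcases cs.length_mul_of_mem (hI hs) (x * v) with h3 | h3
  · omega
  · exact absurd (iff_of_false (by omega) (by omega)) (h1.1 (by omega))

/-- Local minimality is global: let xv be shortest in the coset. If v ≠ 1, a right descent s of v⁻¹
would shorten x, by additivity from xv. -/
theorem length_mul_of_mem_minReps (hI : I ⊆ cs.simpleSet) (hx : x ∈ cs.minReps I)
    (hu : u ∈ Subgroup.closure I) : cs.length (x * u) = cs.length x + cs.length u := by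
  obtain ⟨v, hv, hmin⟩ := exists_minimalFor_of_wellFoundedLT
    (fun v => v ∈ Subgroup.closure I) (fun v => cs.length (x * v)) ⟨1, one_mem _⟩
  have hmin' : ∀ z ∈ Subgroup.closure I, cs.length (x * v) ≤ cs.length (x * v * z) := by
    intro z hz
    rw [mul_assoc]
    rcases le_total (cs.length (x * v)) (cs.length (x * (v * z))) with h | h
    · exact h
    · exact hmin (mul_mem hv hz) h
  have hadd := fun z hz => cs.length_mul_of_forall_reflection (u := z) hI hmin' hz
  by_cases h1 : v = 1
  · subst h1
    simpa using hadd u hu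
  · obtain ⟨s, hs, hlt⟩ := cs.exists_mul_right_lt hI (inv_mem hv) (inv_ne_one.2 h1)
    have h2 := hadd _ (inv_mem hv)
    have h3 := hadd _ (mul_mem (inv_mem hv) (Subgroup.subset_closure hs))
    have h4 := hx s hs
    rw [mul_inv_cancel_right] at h2
    rw [← mul_assoc, mul_inv_cancel_right] at h3
    omega

theorem exists_mul_mem_minReps (hI : I ⊆ cs.simpleSet) (w : W) :
    ∃ x ∈ cs.minReps I, ∃ u ∈ Subgroup.closure I, w = x * u := by
  obtain ⟨v, hv, hmin⟩ := exists_minimalFor_of_wellFoundedLT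
    (fun v => v ∈ Subgroup.closure I) (fun v => cs.length (w * v)) ⟨1, one_mem _⟩
  refine ⟨w * v, ?_, v⁻¹, inv_mem hv, by simp⟩
  intro s hs
  have h := cs.length_mul_of_mem (hI hs) (w * v)
  by_contra hlt
  rw [mul_assoc] at h hlt
  have := hmin (mul_mem hv (Subgroup.subset_closure hs)) (by simp only; omega)
  simp only at this
  omega

/-- The left-handed parabolic decomposition. -/
theorem exists_mul_left_minReps (hI : I ⊆ cs.simpleSet) (w : W) :
    ∃ u ∈ Subgroup.closure I, ∃ b, w = u * b ∧
      ∀ v ∈ Subgroup.closure I, cs.length (v * b) = cs.length v + cs.length b := by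
  obtain ⟨x, hx, u, hu, h⟩ := cs.exists_mul_mem_minReps hI w⁻¹
  refine ⟨u⁻¹, inv_mem hu, x⁻¹, by rw [← mul_inv_rev, ← h, inv_inv], fun v hv => ?_⟩
  have := cs.length_mul_of_mem_minReps hI hx (inv_mem hv)
  rw [← cs.length_inv, mul_inv_rev, inv_inv, this, cs.length_inv, cs.length_inv]
  ring

theorem minReps_anti (h : I ⊆ J) : cs.minReps J ⊆ cs.minReps I :=
  fun _ hx s hs => hx s (h hs)

theorem coset_inj (hI : I ⊆ cs.simpleSet) (hJ : J ⊆ cs.simpleSet) (hx : x ∈ cs.minReps I)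
    (hy : y ∈ cs.minReps J) (h : cs.coset x I hI = cs.coset y J hJ) : x = y ∧ I = J := by
  have h : x • (Subgroup.closure I : Set W) = y • (Subgroup.closure J : Set W) :=
    congrArg Subtype.val h
  have h1 : x ∈ y • (Subgroup.closure J : Set W) := by
    rw [← h]; exact ⟨1, one_mem _, by simp⟩
  have h2 : y ∈ x • (Subgroup.closure I : Set W) := by
    rw [h]; exact ⟨1, one_mem _, by simp⟩
  obtain ⟨u, hu, rfl⟩ := h1
  obtain ⟨v, hv, h2⟩ := h2
  simp only [smul_eq_mul] at h2 hx h ⊢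
  have e1 := cs.length_mul_of_mem_minReps hJ hy hu
  have e2 := cs.length_mul_of_mem_minReps hI hx hv
  rw [h2] at e2
  have hu1 : u = 1 := cs.length_eq_zero_iff.1 (by omega)
  subst hu1
  simp only [mul_one, smul_left_cancel_iff, SetLike.coe_set_eq] at h ⊢
  refine ⟨trivial, Set.Subset.antisymm (fun s hs => ?_) fun s hs => ?_⟩
  · exact cs.mem_of_mem_closure hJ (hI hs) (h ▸ Subgroup.subset_closure hs)
  · exact cs.mem_of_mem_closure hI (hJ hs) (h ▸ Subgroup.subset_closure hs)

theorem exists_coset_eq (C : cs.Complex) :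
    ∃ I, ∃ hI : I ⊆ cs.simpleSet, ∃ x ∈ cs.minReps I, C = cs.coset x I hI := by
  obtain ⟨C, I, hI, w, rfl⟩ := C
  obtain ⟨x, hx, u, hu, rfl⟩ := cs.exists_mul_mem_minReps hI w
  refine ⟨I, hI, x, hx, Subtype.ext ?_⟩
  change (x * u) • (Subgroup.closure I : Set W) = x • (Subgroup.closure I : Set W)
  rw [mul_smul, smul_coe_set hu]

/-! ### Longest elements -/

section Longest

variable [Finite W]

theorem longest_mem (I : Set W) : cs.longest I ∈ Subgroup.closure I :=
  (Classical.choose_spec (cs.exists_longest I)).1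

theorem length_le_longest (hv : v ∈ Subgroup.closure I) :
    cs.length v ≤ cs.length (cs.longest I) :=
  (Classical.choose_spec (cs.exists_longest I)).2 v hv

/-- Every reflection of W_I is an inversion of the longest element. If s lengthens v, the inversion
v s v⁻¹ is therefore not one of v, and the cocycle identity makes s a left descent of the remaining
factor. -/
theorem length_add_length_inv_mul_longest (hI : I ⊆ cs.simpleSet)
    (hv : v ∈ Subgroup.closure I) :
    cs.length v + cs.length (v⁻¹ * cs.longest I) = cs.length (cs.longest I) := by
  refine cs.closure_induction_length hI (P := fun v =>
    cs.length v + cs.length (v⁻¹ * cs.longest I) = cs.length (cs.longest I)) (by simp) ?_ hv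
  intro v hv s hs hl ih
  have hr := cs.isReflection_of_mem (hI hs)
  have hsm : s ∈ Subgroup.closure I := Subgroup.subset_closure hs
  have h1 := cs.length_lt_mul_iff (u := v) (v := v⁻¹ * cs.longest I) (hr.conj v)
  have h2 : cs.length (v * s * v⁻¹ * cs.longest I) < cs.length (cs.longest I) :=
    lt_of_le_of_ne (cs.length_le_longest
      (mul_mem (mul_mem (mul_mem hv hsm) (inv_mem hv)) (cs.longest_mem I)))
      ((hr.conj v).length_mul_right_ne _)
  have e : v⁻¹ * (v * s * v⁻¹) * v * (v⁻¹ * cs.longest I) = s * (v⁻¹ * cs.longest I) := by group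
  rw [mul_inv_cancel_left, inv_mul_cancel_right, e, iff_true_left h2,
    iff_false_left (by omega), not_not] at h1
  rw [mul_inv_rev, cs.inv_of_mem (hI hs), mul_assoc s]
  rcases cs.length_of_mem_mul (hI hs) (v⁻¹ * cs.longest I) with h3 | h3 <;> omega

theorem eq_longest_of_forall_lt (hI : I ⊆ cs.simpleSet) (hu : u ∈ Subgroup.closure I)
    (h : ∀ s ∈ I, cs.length (u * s) < cs.length u) : u = cs.longest I := by
  by_contra hne
  obtain ⟨s, hs, hlt⟩ := cs.exists_mul_left_lt hI (mul_mem (inv_mem hu) (cs.longest_mem I))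
    (by rwa [ne_eq, inv_mul_eq_one])
  have h1 := cs.length_add_length_inv_mul_longest hI hu
  have h2 := cs.length_add_length_inv_mul_longest hI (mul_mem hu (Subgroup.subset_closure hs))
  rw [mul_inv_rev, cs.inv_of_mem (hI hs), mul_assoc s] at h2
  have := h s hs
  omega

theorem longest_inv (hI : I ⊆ cs.simpleSet) : (cs.longest I)⁻¹ = cs.longest I := by
  refine cs.eq_longest_of_forall_lt hI (inv_mem (cs.longest_mem I)) fun s hs => ?_
  have := cs.length_le_longest
    (mul_mem (inv_mem (cs.longest_mem I)) (Subgroup.subset_closure hs))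
  rw [cs.length_inv]
  have h := (cs.isReflection_of_mem (hI hs)).length_mul_left_ne (cs.longest I)⁻¹
  rw [cs.length_inv] at h
  omega

theorem longest_mul_self (hI : I ⊆ cs.simpleSet) : cs.longest I * cs.longest I = 1 := by
  rw [mul_eq_one_iff_eq_inv, cs.longest_inv hI]

theorem length_longest_mul (hI : I ⊆ cs.simpleSet) (hv : v ∈ Subgroup.closure I) :
    cs.length v + cs.length (cs.longest I * v) = cs.length (cs.longest I) := by
  rw [← cs.length_add_length_inv_mul_longest hI hv, ← cs.length_inv (v⁻¹ * _), mul_inv_rev,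
    cs.longest_inv hI, inv_inv]

theorem longest_mul_lt (hI : I ⊆ cs.simpleSet) (hs : s ∈ I) :
    cs.length (cs.longest I * s) < cs.length (cs.longest I) := by
  have := cs.length_longest_mul hI (Subgroup.subset_closure hs)
  have := cs.length_of_mem (hI hs)
  omega

theorem mul_longest_lt (hI : I ⊆ cs.simpleSet) (hs : s ∈ I) :
    cs.length (s * cs.longest I) < cs.length (cs.longest I) := by
  have h := cs.longest_mul_lt hI hs
  rwa [← cs.length_inv, mul_inv_rev, cs.inv_of_mem (hI hs), cs.longest_inv hI] at h

theorem longest_empty : cs.longest (∅ : Set W) = 1 :=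
  (cs.eq_longest_of_forall_lt (Set.empty_subset _) (one_mem _) (by simp)).symm

theorem longest_singleton (hs : s ∈ cs.simpleSet) : cs.longest {s} = s := by
  refine (cs.eq_longest_of_forall_lt (by simpa)
    (Subgroup.subset_closure (Set.mem_singleton s)) ?_).symm
  rintro t rfl
  rw [cs.mul_self_of_mem hs, cs.length_of_mem hs, cs.length_one]
  exact one_pos

/-- An element with all of `I` as left descents lies above `longest I`. -/
theorem longest_le_of_forall_lt (hI : I ⊆ cs.simpleSet)
    (h : ∀ s ∈ I, cs.length (s * w) < cs.length w) :
    cs.length (cs.longest I) + cs.length (cs.longest I * w) = cs.length w := by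
  obtain ⟨u, hu, b, rfl, hb⟩ := cs.exists_mul_left_minReps hI w
  have hu' : u⁻¹ = cs.longest I := by
    refine cs.eq_longest_of_forall_lt hI (inv_mem hu) fun s hs => ?_
    have h1 := h s hs
    rw [← mul_assoc, hb u hu, hb _ (mul_mem (Subgroup.subset_closure hs) hu)] at h1
    rw [← cs.length_inv, mul_inv_rev, inv_inv, cs.inv_of_mem (hI hs), cs.length_inv]
    omega
  rw [← hu', inv_mul_cancel_left, hb u hu, cs.length_inv]

theorem length_mul_longest_of_forall_lt (hI : I ⊆ cs.simpleSet)
    (h : ∀ s ∈ I, cs.length (w * s) < cs.length w) :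
    cs.length (cs.longest I) + cs.length (w * cs.longest I) = cs.length w := by
  have h' : ∀ s ∈ I, cs.length (s * w⁻¹) < cs.length w⁻¹ := ?_
  · have h1 := cs.longest_le_of_forall_lt hI h'
    rwa [← cs.length_inv (_ * w⁻¹), mul_inv_rev, cs.longest_inv hI, inv_inv,
      cs.length_inv w] at h1
  intro s hs
  have := h s hs
  rwa [← cs.length_inv, mul_inv_rev, inv_inv, cs.inv_of_mem (hI hs), cs.length_inv w]

theorem mul_longest_mem_minReps (hI : I ⊆ cs.simpleSet)
    (h : ∀ s ∈ I, cs.length (w * s) < cs.length w) : w * cs.longest I ∈ cs.minReps I := by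
  obtain ⟨x, hx, u, hu, rfl⟩ := cs.exists_mul_mem_minReps hI w
  have hu' : u = cs.longest I := by
    refine cs.eq_longest_of_forall_lt hI hu fun s hs => ?_
    have h1 := h s hs
    rw [mul_assoc, cs.length_mul_of_mem_minReps hI hx hu, cs.length_mul_of_mem_minReps hI hx
      (mul_mem hu (Subgroup.subset_closure hs))] at h1
    omega
  rwa [hu', mul_assoc, cs.longest_mul_self hI, mul_one]

theorem mul_longest_mul_lt (hI : I ⊆ cs.simpleSet) (hx : x ∈ cs.minReps I) (hs : s ∈ I) :
    cs.length (x * cs.longest I * s) < cs.length (x * cs.longest I) := by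
  have := cs.longest_mul_lt hI hs
  rw [mul_assoc, cs.length_mul_of_mem_minReps hI hx (cs.longest_mem I),
    cs.length_mul_of_mem_minReps hI hx
      (mul_mem (cs.longest_mem I) (Subgroup.subset_closure hs))]
  omega

theorem length_mul_longest (hI : I ⊆ cs.simpleSet) (hx : x ∈ cs.minReps I) :
    cs.length (x * cs.longest I) = cs.length x + cs.length (cs.longest I) :=
  cs.length_mul_of_mem_minReps hI hx (cs.longest_mem I)

end Longest

/-! ### The weak order -/

theorem toWeak_le_iff :
    cs.toWeak u ≤ cs.toWeak v ↔ cs.length u + cs.length (u⁻¹ * v) = cs.length v :=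
  Iff.rfl

theorem toWeak_le_mul (h : cs.length (u * v) = cs.length u + cs.length v) :
    cs.toWeak u ≤ cs.toWeak (u * v) := by
  rw [toWeak_le_iff, inv_mul_cancel_left, h]

theorem toWeak_inj : cs.toWeak u = cs.toWeak v ↔ u = v := Iff.rfl

theorem toWeak_one_le : cs.toWeak 1 ≤ cs.toWeak u := by
  simp [toWeak_le_iff]

theorem length_le_of_toWeak_le (h : cs.toWeak u ≤ cs.toWeak v) : cs.length u ≤ cs.length v := by
  rw [toWeak_le_iff] at h
  omega

theorem toWeak_le_of_mem_minReps (hI : I ⊆ cs.simpleSet) (hx : x ∈ cs.minReps I)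
    (hu : u ∈ Subgroup.closure I) : cs.toWeak x ≤ cs.toWeak (x * u) :=
  cs.toWeak_le_mul (cs.length_mul_of_mem_minReps hI hx hu)

theorem mem_simpleSet_of_length_eq_one (h : cs.length s = 1) : s ∈ cs.simpleSet := by
  obtain ⟨i, rfl⟩ := cs.length_eq_one_iff.1 h
  exact ⟨i, rfl⟩

theorem closure_simpleSet : Subgroup.closure cs.simpleSet = ⊤ :=
  cs.subgroup_closure_range_simple

/-- Elements of `W_I` below `a v`, with `a` minimal in its double coset and `v ∈ W_J`, lie in the
parabolic subgroup generated by `I ∩ a J a⁻¹`. -/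
theorem mem_closure_of_le_mul (hI : I ⊆ cs.simpleSet) (hJ : J ⊆ cs.simpleSet) {a : W}
    (ha : ∀ u ∈ Subgroup.closure I, cs.length (u * a) = cs.length u + cs.length a)
    (haJ : a ∈ cs.minReps J) (hv : v ∈ Subgroup.closure J) (hu : u ∈ Subgroup.closure I)
    (h : cs.toWeak u ≤ cs.toWeak (a * v)) :
    u ∈ Subgroup.closure {s ∈ I | a⁻¹ * s * a ∈ J} := by
  rw [toWeak_le_iff] at h
  induction hn : cs.length u using Nat.strong_induction_on generalizing u v with
  | _ n ih =>
    by_cases h1 : u = 1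
    · rw [h1]; exact one_mem _
    obtain ⟨s, hs, hlt⟩ := cs.exists_mul_left_lt hI hu h1
    have hsm : s ∈ Subgroup.closure I := Subgroup.subset_closure hs
    have hr := cs.isReflection_of_mem (hI hs)
    have hs1 := cs.length_of_mem (hI hs)
    have hsl := cs.length_of_mem_mul (hI hs) u
    have hsa := ha s hsm
    have hsl' := cs.length_of_mem_mul (hI hs) (a * v)
    have hlt' : cs.length (s * (a * v)) < cs.length (a * v) := by
      have h2 := cs.length_mul_le (s * u) (u⁻¹ * (a * v))
      have e : s * u * (u⁻¹ * (a * v)) = s * (a * v) := by group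
      rw [e] at h2
      omega
    -- As s lengthens a, the inversion s of av must come from v, as a⁻¹sa.
    have hv' : cs.length (a⁻¹ * s * a * v) < cs.length v := by
      by_contra h3
      exact (cs.length_lt_mul_iff hr).1 hlt' (iff_of_false (by omega) h3)
    have hr' : cs.IsReflection (a⁻¹ * s * a) := by
      simpa using hr.conj a⁻¹
    have htJ := cs.mem_closure_of_length_mul_left_lt hJ hv hr' hv'
    have hl := cs.length_mul_of_mem_minReps hJ haJ htJ
    have e : a * (a⁻¹ * s * a) = s * a := by group
    rw [e] at hl
    -- Comparing ℓ(sa) = 1 + ℓ(a) with additivity over W_J shows that a⁻¹sa has length 1.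
    have hmem : a⁻¹ * s * a ∈ J := cs.mem_of_mem_closure hJ
      (cs.mem_simpleSet_of_length_eq_one (by omega)) htJ
    have e2 : a * (a⁻¹ * s * a * v) = s * (a * v) := by group
    have e3 : (s * u)⁻¹ * (s * (a * v)) = u⁻¹ * (a * v) := by group
    have := ih (cs.length (s * u)) (by omega) (u := s * u) (v := a⁻¹ * s * a * v)
      (mul_mem htJ hv) (mul_mem hsm hu) (by rw [e2, e3]; omega) rfl
    rw [← cs.self_mul_mul_of_mem (hI hs) u]
    exact mul_mem (Subgroup.subset_closure ⟨hs, hmem⟩) this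

section Finite

variable [Finite W]

theorem mul_toWeak_le_mul_longest (hI : I ⊆ cs.simpleSet) (hx : x ∈ cs.minReps I)
    (hu : u ∈ Subgroup.closure I) : cs.toWeak (x * u) ≤ cs.toWeak (x * cs.longest I) := by
  have h := cs.length_add_length_inv_mul_longest hI hu
  have e : (x * u)⁻¹ * (x * cs.longest I) = u⁻¹ * cs.longest I := by group
  rw [toWeak_le_iff, e, cs.length_mul_of_mem_minReps hI hx hu, cs.length_mul_longest hI hx]
  omega

/-- The maximum of the coset is the join of x and its atoms xs: an element with all of I as left
descents has `longest I` as a prefix. -/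
theorem mul_longest_toWeak_le (hI : I ⊆ cs.simpleSet) (hx : x ∈ cs.minReps I)
    (h : cs.toWeak x ≤ cs.toWeak w) (hs : ∀ s ∈ I, cs.toWeak (x * s) ≤ cs.toWeak w) :
    cs.toWeak (x * cs.longest I) ≤ cs.toWeak w := by
  rw [toWeak_le_iff] at h
  have h1 := cs.longest_le_of_forall_lt hI (w := x⁻¹ * w) fun s hsI => by
    have h2 := hs s hsI
    have h3 := cs.length_of_mem_mul (hI hsI) (x⁻¹ * w)
    have h4 := cs.length_mul_of_mem_minReps hI hx (Subgroup.subset_closure hsI)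
    have h5 := cs.length_of_mem (hI hsI)
    rw [toWeak_le_iff, mul_inv_rev, cs.inv_of_mem (hI hsI), mul_assoc s] at h2
    omega
  rw [toWeak_le_iff, mul_inv_rev, cs.longest_inv hI, mul_assoc _ x⁻¹,
    cs.length_mul_longest hI hx]
  omega

theorem length_longest_lt_insert (hI : I ⊆ cs.simpleSet) (hs : s ∈ cs.simpleSet) (hsI : s ∉ I) :
    cs.length (cs.longest I) < cs.length (cs.longest (insert s I)) := by
  have h := cs.length_add_length_inv_mul_longest (Set.insert_subset hs hI)
    (Subgroup.closure_mono (Set.subset_insert s I) (cs.longest_mem I))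
  by_contra hlt
  have h1 : (cs.longest I)⁻¹ * cs.longest (insert s I) = 1 :=
    cs.length_eq_zero_iff.1 (by omega)
  rw [inv_mul_eq_one] at h1
  refine hsI (cs.mem_of_length_mul_lt hI (cs.longest_mem I) hs ?_)
  rw [h1]
  exact cs.longest_mul_lt (Set.insert_subset hs hI) (Set.mem_insert s I)

theorem length_longest_sdiff_lt (hI : I ⊆ cs.simpleSet) (hs : s ∈ I) :
    cs.length (cs.longest (I \ {s})) < cs.length (cs.longest I) := by
  have h := cs.length_longest_lt_insert (I := I \ {s}) (Set.sdiff_subset.trans hI) (hI hs)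
    (by simp)
  rwa [Set.insert_sdiff_singleton, Set.insert_eq_of_mem hs] at h

/-! ### The facial weak order -/

theorem mul_longest_mul_longest_mem_minReps (hI : I ⊆ cs.simpleSet) (hx : x ∈ cs.minReps I)
    (h : J ⊆ I) : x * cs.longest I * cs.longest J ∈ cs.minReps J :=
  cs.mul_longest_mem_minReps (h.trans hI) fun _ hs => cs.mul_longest_mul_lt hI hx (h hs)

theorem exists_rep_of_facialStep {C D : cs.Complex} (h : cs.FacialStep C D) :
    ∃ I, ∃ hI : I ⊆ cs.simpleSet, ∃ x ∈ cs.minReps I,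
      ∃ J, ∃ hJ : J ⊆ cs.simpleSet, ∃ y ∈ cs.minReps J, C = cs.coset x I hI ∧
        D = cs.coset y J hJ ∧ cs.toWeak x ≤ cs.toWeak y ∧
        cs.toWeak (x * cs.longest I) ≤ cs.toWeak (y * cs.longest J) := by
  cases h with
  | up I hI x hx s hs hsI hxs =>
    exact ⟨I, hI, x, hx, _, Set.insert_subset hs hI, x, hxs, rfl, rfl, le_rfl,
      cs.mul_toWeak_le_mul_longest (Set.insert_subset hs hI) hxs
        (Subgroup.closure_mono (Set.subset_insert s I) (cs.longest_mem I))⟩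
  | down I hI x hx s hs =>
    refine ⟨I, hI, x, hx, _, Set.sdiff_subset.trans hI, _,
      cs.mul_longest_mul_longest_mem_minReps hI hx Set.sdiff_subset, rfl, rfl, ?_, ?_⟩
    · rw [mul_assoc]
      exact cs.toWeak_le_of_mem_minReps hI hx (mul_mem (cs.longest_mem I)
        (Subgroup.closure_mono Set.sdiff_subset (cs.longest_mem _)))
    · rw [mul_assoc _ (cs.longest (I \ {s})), cs.longest_mul_self (Set.sdiff_subset.trans hI),
        mul_one]

theorem toWeak_le_of_coset_le {C D : cs.Complex} (h : C ≤ D) :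
    ∀ {I} {hI : I ⊆ cs.simpleSet} {x}, x ∈ cs.minReps I → C = cs.coset x I hI →
    ∀ {J} {hJ : J ⊆ cs.simpleSet} {y}, y ∈ cs.minReps J → D = cs.coset y J hJ →
      cs.toWeak x ≤ cs.toWeak y ∧
        cs.toWeak (x * cs.longest I) ≤ cs.toWeak (y * cs.longest J) := by
  induction h with
  | refl =>
    rintro I hI x hx rfl J hJ y hy h
    obtain ⟨rfl, rfl⟩ := cs.coset_inj hI hJ hx hy h
    exact ⟨le_rfl, le_rfl⟩
  | tail _ hstep ih =>
    intro I hI x hx hC J hJ y hy hD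
    obtain ⟨I', hI', x', hx', J', hJ', y', hy', rfl, rfl, h1, h2⟩ :=
      cs.exists_rep_of_facialStep hstep
    obtain ⟨rfl, rfl⟩ := cs.coset_inj hJ' hJ hy' hy hD
    obtain ⟨h3, h4⟩ := ih hx hC hx' rfl
    exact ⟨h3.trans h1, h4.trans h2⟩

theorem exists_facialStep_up (hI : I ⊆ cs.simpleSet) (hx : x ∈ cs.minReps I)
    (hs : s ∈ cs.simpleSet) (hsI : s ∉ I) (hxs : x ∈ cs.minReps (insert s I))
    (h1 : cs.toWeak (x * cs.longest I) ≤ cs.toWeak w) (h2 : cs.toWeak (x * s) ≤ cs.toWeak w) :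
    ∃ I', ∃ hI' : I' ⊆ cs.simpleSet, ∃ x' ∈ cs.minReps I',
      cs.FacialStep (cs.coset x I hI) (cs.coset x' I' hI') ∧ x' = x ∧
      cs.toWeak (x' * cs.longest I') ≤ cs.toWeak w ∧
      cs.length x + cs.length (x * cs.longest I) <
        cs.length x' + cs.length (x' * cs.longest I') := by
  have hI' := Set.insert_subset hs hI
  refine ⟨insert s I, hI', x, hxs, .up I hI x hx s hs hsI hxs, rfl, ?_, ?_⟩
  · refine cs.mul_longest_toWeak_le hI' hxs
      ((cs.toWeak_le_of_mem_minReps hI hx (cs.longest_mem I)).trans h1) ?_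
    rintro r (rfl | hr)
    · exact h2
    · exact (cs.mul_toWeak_le_mul_longest hI hx (Subgroup.subset_closure hr)).trans h1
  · rw [cs.length_mul_longest hI hx, cs.length_mul_longest hI' hxs]
    have := cs.length_longest_lt_insert hI hs hsI
    omega

/-- This is the hard half of `coset_le_iff`: a step can be taken toward the target without
overshooting its minimum or maximum, while the sum of the two lengths strictly grows. -/
theorem exists_facialStep (hI : I ⊆ cs.simpleSet) (hJ : J ⊆ cs.simpleSet)
    (hx : x ∈ cs.minReps I) (hy : y ∈ cs.minReps J) (hxy : cs.toWeak x ≤ cs.toWeak y)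
    (hmax : cs.toWeak (x * cs.longest I) ≤ cs.toWeak (y * cs.longest J))
    (hne : ¬ (x = y ∧ I = J)) :
    ∃ I', ∃ hI' : I' ⊆ cs.simpleSet, ∃ x' ∈ cs.minReps I',
      cs.FacialStep (cs.coset x I hI) (cs.coset x' I' hI') ∧ cs.toWeak x' ≤ cs.toWeak y ∧
      cs.toWeak (x' * cs.longest I') ≤ cs.toWeak (y * cs.longest J) ∧
      cs.length x + cs.length (x * cs.longest I) <
        cs.length x' + cs.length (x' * cs.longest I') := by
  have hyn := cs.toWeak_le_of_mem_minReps hJ hy (cs.longest_mem J)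
  by_cases hup : ∃ s ∈ cs.simpleSet, s ∉ I ∧ cs.length x < cs.length (x * s) ∧
      cs.toWeak (x * s) ≤ cs.toWeak (y * cs.longest J)
  · obtain ⟨s, hs, hsI, hlt, h⟩ := hup
    have hxs : x ∈ cs.minReps (insert s I) := by
      rintro r (rfl | hr)
      exacts [hlt, hx r hr]
    obtain ⟨I', hI', x', hx', h1, rfl, h2, h3⟩ :=
      cs.exists_facialStep_up hI hx hs hsI hxs hmax h
    exact ⟨I', hI', x', hx', h1, hxy, h2, h3⟩
  -- Split x⁻¹y along W_I. If a₁ = 1, an upward step is still available, a contradiction; if a₁ ≠ 1,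
  -- a downward step works.
  obtain ⟨a₁, ha₁, a₂, ha, ha₂⟩ := cs.exists_mul_left_minReps hI (x⁻¹ * y)
  obtain rfl : y = x * (a₁ * a₂) := by rw [← ha]; group
  have hla : cs.length (x * (a₁ * a₂)) = cs.length x + cs.length (a₁ * a₂) := by
    rw [toWeak_le_iff, inv_mul_cancel_left] at hxy
    exact hxy.symm
  by_cases h1 : a₁ = 1
  · subst h1
    simp only [one_mul] at *
    by_cases h2 : a₂ = 1
    · subst h2
      simp only [mul_one, true_and] at *
      have hIJ : I ⊆ J := by
        intro r hr
        have h3 := (cs.mul_toWeak_le_mul_longest hI hx (Subgroup.subset_closure hr)).trans hmax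
        have h4 := hx r hr
        have h5 := cs.length_mul_longest hJ hy
        have e : (x * r)⁻¹ * (x * cs.longest J) = r⁻¹ * cs.longest J := by group
        rw [toWeak_le_iff, e, cs.inv_of_mem (hI hr)] at h3
        exact cs.mem_of_length_mul_left_lt hJ (cs.longest_mem J) (hI hr) (by omega)
      obtain ⟨s, hsJ, hsI⟩ := Set.exists_of_ssubset (hIJ.ssubset_of_ne hne)
      exact absurd ⟨s, hJ hsJ, hsI, hy s hsJ,
        cs.mul_toWeak_le_mul_longest hJ hy (Subgroup.subset_closure hsJ)⟩ hup
    · obtain ⟨s, hs, hlt⟩ := cs.exists_mul_left_lt subset_rfl (w := a₂)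
        (by rw [closure_simpleSet]; trivial) h2
      have h3 := cs.length_mul_le (x * s) (s * a₂)
      have h4 := cs.length_of_mem_mul hs a₂
      have h5 := cs.length_mul_of_mem hs x
      have e : x * s * (s * a₂) = x * a₂ := by
        rw [mul_assoc, cs.self_mul_mul_of_mem hs]
      rw [e] at h3
      refine absurd ⟨s, hs, fun hsI => ?_, by omega, le_trans ?_ hyn⟩ hup
      · have := ha₂ s (Subgroup.subset_closure hsI)
        omega
      · rw [← e]
        exact cs.toWeak_le_mul (by rw [e]; omega)
  · have hI₁ := cs.length_add_length_inv_mul_longest hI ha₁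
    have hI₂ := cs.length_add_length_inv_mul_longest hI (inv_mem ha₁)
    rw [inv_inv, cs.length_inv] at hI₂
    have hp : a₁⁻¹ * cs.longest I ∈ Subgroup.closure I := mul_mem (inv_mem ha₁) (cs.longest_mem I)
    have hl₁ := ha₂ a₁ ha₁
    have ha₂J : a₂ ∈ cs.minReps J := by
      intro r hr
      have h3 := hy r hr
      have h4 := cs.length_mul_le (x * a₁) (a₂ * r)
      have h5 := cs.length_mul_le x a₁
      have e : x * a₁ * (a₂ * r) = x * (a₁ * a₂) * r := by group
      rw [e] at h4
      omega
    have hlJ := cs.length_mul_longest hJ hy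
    have hl₂ := cs.length_mul_longest hJ ha₂J
    have hlI := cs.length_mul_longest hI hx
    have hmem := cs.mem_closure_of_le_mul hI hJ ha₂ ha₂J (cs.longest_mem J) hp (by
      have e : (x * cs.longest I)⁻¹ * (x * (a₁ * a₂) * cs.longest J) =
        (a₁⁻¹ * cs.longest I)⁻¹ * (a₂ * cs.longest J) := by group
      rw [toWeak_le_iff, e] at hmax
      rw [toWeak_le_iff]
      omega)
    -- If conjugation sent all of I into J, `longest I` would be a prefix of a₂ w_J, and its
    -- cancellation against a₁ would violate additivity of lengths unless a₁ = 1.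
    have hex : ∃ t ∈ I, a₂⁻¹ * t * a₂ ∉ J := by
      by_contra! hall
      have h3 := cs.longest_le_of_forall_lt hI (w := a₂ * cs.longest J) fun s hs => by
        have h4 := cs.mul_longest_lt hJ (hall s hs)
        have h5 := cs.length_mul_of_mem_minReps hJ ha₂J
          (mul_mem (Subgroup.subset_closure (hall s hs)) (cs.longest_mem J))
        have e : a₂ * (a₂⁻¹ * s * a₂ * cs.longest J) = s * (a₂ * cs.longest J) := by group
        rw [e] at h5
        omega
      have h4 := cs.length_mul_le (a₁ * cs.longest I) (cs.longest I * (a₂ * cs.longest J))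
      have e : a₁ * cs.longest I * (cs.longest I * (a₂ * cs.longest J)) =
          a₁ * (a₂ * cs.longest J) := by
        rw [mul_assoc, ← mul_assoc (cs.longest I), cs.longest_mul_self hI, one_mul]
      have h5 := cs.length_mul_le x (a₁ * (a₂ * cs.longest J))
      have e2 : x * (a₁ * (a₂ * cs.longest J)) = x * (a₁ * a₂) * cs.longest J := by group
      rw [e] at h4
      rw [e2] at h5
      exact h1 (cs.length_eq_zero_iff.1 (by omega))
    obtain ⟨t, ht, htJ⟩ := hex
    have hL : I \ {t} ⊆ cs.simpleSet := Set.sdiff_subset.trans hI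
    have hpL : a₁⁻¹ * cs.longest I ∈ Subgroup.closure (I \ {t}) := by
      refine Subgroup.closure_mono ?_ hmem
      rintro r ⟨hr, hrJ⟩
      exact ⟨hr, by rintro rfl; exact htJ hrJ⟩
    have hxL := cs.mul_longest_mul_longest_mem_minReps hI hx (J := I \ {t}) Set.sdiff_subset
    have eL : x * cs.longest I * cs.longest (I \ {t}) * cs.longest (I \ {t}) =
        x * cs.longest I := by
      rw [mul_assoc _ (cs.longest (I \ {t})), cs.longest_mul_self hL, mul_one]
    have hlL := cs.length_mul_longest hL hxL
    rw [eL] at hlL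
    have hltL := cs.length_longest_sdiff_lt hI ht
    -- Removing t keeps the maximum x w_I. The new minimum stays below y because a₁⁻¹ w_I lies in
    -- the parabolic subgroup of I without t.
    refine ⟨_, hL, _, hxL, .down I hI x hx t ht, ?_, by rwa [eL], by rw [eL]; omega⟩
    have h3 := cs.length_longest_mul hL (inv_mem hpL)
    have h4 := ha₂ _ (mul_mem (Subgroup.closure_mono Set.sdiff_subset (cs.longest_mem (I \ {t})))
      (inv_mem hp))
    rw [cs.length_inv] at h3
    have e : x * cs.longest I * cs.longest (I \ {t}) *
        (cs.longest (I \ {t}) * (a₁⁻¹ * cs.longest I)⁻¹ * a₂) = x * (a₁ * a₂) := by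
      calc _ = x * cs.longest I * (cs.longest (I \ {t}) * cs.longest (I \ {t})) *
            (a₁⁻¹ * cs.longest I)⁻¹ * a₂ := by group
        _ = _ := by
          rw [cs.longest_mul_self hL]
          group
    rw [← e]
    refine cs.toWeak_le_mul ?_
    rw [e]
    omega

/-- The facial weak order compares the minima and the maxima of the cosets. -/
theorem coset_le_iff (hI : I ⊆ cs.simpleSet) (hJ : J ⊆ cs.simpleSet)
    (hx : x ∈ cs.minReps I) (hy : y ∈ cs.minReps J) :
    cs.coset x I hI ≤ cs.coset y J hJ ↔ cs.toWeak x ≤ cs.toWeak y ∧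
      cs.toWeak (x * cs.longest I) ≤ cs.toWeak (y * cs.longest J) := by
  refine ⟨fun h => cs.toWeak_le_of_coset_le h hx rfl hy rfl, fun ⟨h1, h2⟩ => ?_⟩
  induction hn : cs.length y + cs.length (y * cs.longest J) -
    (cs.length x + cs.length (x * cs.longest I)) using Nat.strong_induction_on
    generalizing x I with
  | _ n ih =>
    by_cases hne : x = y ∧ I = J
    · obtain ⟨rfl, rfl⟩ := hne
      exact le_rfl
    obtain ⟨I', hI', x', hx', hstep, h3, h4, h5⟩ :=
      cs.exists_facialStep hI hJ hx hy h1 h2 hne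
    have h6 := cs.length_le_of_toWeak_le h3
    have h7 := cs.length_le_of_toWeak_le h4
    exact (Relation.ReflTransGen.single hstep).trans (ih _ (by omega) hI' hx' ⟨h3, h4⟩ h3 h4 rfl)

end Finite

end CoxeterSystem

/-! ### Irreducible elements of a preorder -/

/-- It suffices to test the largest candidate set, all y ≤ x with y ≠ x; z is an upper bound
witnessing that x is not its join. -/
theorem isJoinIrreducible_iff_exists {α : Type*} [Preorder α] {x : α} :
    IsJoinIrreducible x ↔ ∃ z, (∀ y ≤ x, y ≠ x → y ≤ z) ∧ ¬ x ≤ z := by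
  constructor
  · intro h
    by_contra! hc
    exact h ⟨{y | y ≤ x ∧ y ≠ x}, by simp, fun y hy => hy.1,
      fun z hz => hc z fun y hy hne => hz ⟨hy, hne⟩⟩
  · rintro ⟨z, hz, hxz⟩ ⟨Y, hxY, hY⟩
    exact hxz (hY.2 fun y hy => hz y (hY.1 hy) (by rintro rfl; exact hxY hy))

theorem isMeetIrreducible_iff_of_orderIso {α : Type*} [Preorder α] (e : α ≃o αᵒᵈ) (x : α) :
    IsMeetIrreducible x ↔ IsJoinIrreducible (OrderDual.ofDual (e x)) := by
  refine not_congr ⟨?_, ?_⟩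
  · rintro ⟨Y, hxY, hY⟩
    refine ⟨OrderDual.toDual ⁻¹' (e '' Y), ?_, (e.isGLB_image' (s := Y) (x := x)).2 hY⟩
    rintro ⟨y, hy, h⟩
    exact hxY (e.injective h ▸ hy)
  · rintro ⟨Y, hxY, hY⟩
    refine ⟨e ⁻¹' (OrderDual.ofDual ⁻¹' Y), hxY, ?_⟩
    rw [← e.isGLB_image', Set.image_preimage_eq _ e.surjective]
    exact hY

namespace CoxeterSystem

variable {B W : Type*} [Group W] {M : CoxeterMatrix B} (cs : CoxeterSystem M W)
variable {I J : Set W} {s t u v w x y z : W}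

/-! ### Inversions and the weak order -/

theorem length_mul_lt_of_toWeak_le (h : cs.toWeak u ≤ cs.toWeak v)
    (ht : cs.length (t * u) < cs.length u) : cs.length (t * v) < cs.length v := by
  rw [toWeak_le_iff] at h
  have h1 := cs.length_mul_le (t * u) (u⁻¹ * v)
  have e : t * u * (u⁻¹ * v) = t * v := by group
  rw [e] at h1
  omega

/-- Remove a right descent s of u. By induction us ≤ v; the extra inversion u s u⁻¹ of u is also one
of v, so s begins the remaining factor (us)⁻¹v. -/
theorem toWeak_le_of_forall_reflection
    (h : ∀ t, cs.IsReflection t → cs.length (t * u) < cs.length u →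
      cs.length (t * v) < cs.length v) : cs.toWeak u ≤ cs.toWeak v := by
  induction hn : cs.length u using Nat.strong_induction_on generalizing u with
  | _ n ih =>
    by_cases h1 : u = 1
    · rw [h1]; exact cs.toWeak_one_le
    obtain ⟨s, hs, hlt⟩ := cs.exists_mul_right_lt subset_rfl (w := u)
      (by rw [closure_simpleSet]; trivial) h1
    have hr := cs.isReflection_of_mem hs
    have hl := cs.length_mul_of_mem hs u
    have hle : cs.toWeak (u * s) ≤ cs.toWeak u := by
      have hl' := cs.toWeak_le_mul (u := u * s) (v := s)
        (by rw [cs.mul_mul_self_of_mem hs, cs.length_of_mem hs]; omega)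
      rwa [cs.mul_mul_self_of_mem hs] at hl'
    have ih' := ih _ (by omega) (u := u * s)
      (fun t ht htu => h t ht (cs.length_mul_lt_of_toWeak_le hle htu)) rfl
    have e1 : u * s * u⁻¹ * u = u * s := by group
    have h2 := h _ (hr.conj u) (by rw [e1]; exact hlt)
    have h3 := cs.length_lt_mul_iff (u := u * s) (v := (u * s)⁻¹ * v) (hr.conj u)
    have e2 : u * s * u⁻¹ * (u * s) = u := by
      rw [← mul_assoc, e1, cs.mul_mul_self_of_mem hs]
    have e3 : (u * s)⁻¹ * u * ((u * s)⁻¹ * v) = u⁻¹ * v := by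
      rw [mul_inv_rev, cs.inv_of_mem hs, mul_assoc s, inv_mul_cancel, mul_one, mul_assoc s,
        cs.self_mul_mul_of_mem hs]
    rw [mul_inv_cancel_left, mul_assoc (u * s)⁻¹, e2, e3, iff_true_left h2,
      iff_false_left (by omega), not_not, mul_inv_rev, cs.inv_of_mem hs, mul_assoc s] at h3
    rw [toWeak_le_iff, mul_inv_rev, cs.inv_of_mem hs, mul_assoc s] at ih'
    have h4 := cs.length_of_mem_mul hs (u⁻¹ * v)
    rw [toWeak_le_iff]
    omega

theorem mem_closure_inter (hI : I ⊆ cs.simpleSet) (hJ : J ⊆ cs.simpleSet)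
    (hwI : w ∈ Subgroup.closure I) (hwJ : w ∈ Subgroup.closure J) :
    w ∈ Subgroup.closure (I ∩ J) := by
  induction hn : cs.length w using Nat.strong_induction_on generalizing w with
  | _ n ih =>
    by_cases h1 : w = 1
    · rw [h1]; exact one_mem _
    obtain ⟨s, hs, hlt⟩ := cs.exists_mul_right_lt hI hwI h1
    have hsJ := cs.mem_of_length_mul_lt hJ hwJ (hI hs) hlt
    have h2 := ih _ (by omega) (mul_mem hwI (Subgroup.subset_closure hs))
      (mul_mem hwJ (Subgroup.subset_closure hsJ)) rfl
    rw [← cs.mul_mul_self_of_mem (hI hs) w]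
    exact mul_mem h2 (Subgroup.subset_closure ⟨hs, hsJ⟩)

/-! ### Left multiplication on the Coxeter complex -/

/-- Left multiplication on the Coxeter complex. -/
def mulComplex (w : W) (C : cs.Complex) : cs.Complex :=
  ⟨w • C.1, by
    obtain ⟨C, I, hI, x, rfl⟩ := C
    exact ⟨I, hI, w * x, smul_smul _ _ _⟩⟩

theorem mulComplex_coset (hI : I ⊆ cs.simpleSet) :
    cs.mulComplex w (cs.coset x I hI) = cs.coset (w * x) I hI :=
  Subtype.ext (smul_smul _ _ _)

theorem coset_mul_of_mem (hI : I ⊆ cs.simpleSet) (hu : u ∈ Subgroup.closure I) :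
    cs.coset (x * u) I hI = cs.coset x I hI := by
  refine Subtype.ext ?_
  change (x * u) • (Subgroup.closure I : Set W) = x • (Subgroup.closure I : Set W)
  rw [mul_smul, smul_coe_set hu]

section Finite

variable [Finite W]

/-- An inversion t of w missing from z is missing from both lower elements, so w⁻¹tw lies in W_I and
in W_J, hence in W_{I ∩ J}. Such a t lengthens w w_{I ∩ J}, which is minimal in its coset. -/
theorem mul_longest_inter_toWeak_le (hI : I ⊆ cs.simpleSet) (hJ : J ⊆ cs.simpleSet)
    (hwI : ∀ s ∈ I, cs.length (w * s) < cs.length w)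
    (h1 : cs.toWeak (w * cs.longest I) ≤ cs.toWeak z)
    (h2 : cs.toWeak (w * cs.longest J) ≤ cs.toWeak z) :
    cs.toWeak (w * cs.longest (I ∩ J)) ≤ cs.toWeak z := by
  have hIJ : I ∩ J ⊆ cs.simpleSet := Set.inter_subset_left.trans hI
  have hx := cs.mul_longest_mem_minReps hIJ (w := w) fun s hs => hwI s hs.1
  set x := w * cs.longest (I ∩ J) with hxdef
  have hw : w = x * cs.longest (I ∩ J) := by
    rw [hxdef, mul_assoc, cs.longest_mul_self hIJ, mul_one]
  have key : ∀ K ⊆ cs.simpleSet, cs.toWeak (w * cs.longest K) ≤ cs.toWeak z →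
      ∀ t, cs.IsReflection t → cs.length (t * w) < cs.length w →
      ¬ cs.length (t * z) < cs.length z → w⁻¹ * t * w ∈ Subgroup.closure K := by
    intro K hK hle t ht htw htz
    have h3 := cs.length_lt_mul_iff (u := w * cs.longest K) (v := cs.longest K) ht
    have h4 : ¬ cs.length (t * (w * cs.longest K)) < cs.length (w * cs.longest K) :=
      fun h => htz (cs.length_mul_lt_of_toWeak_le hle h)
    rw [mul_assoc w, cs.longest_mul_self hK, mul_one, iff_true_left htw, iff_false_left h4,
      not_not] at h3
    have hr : cs.IsReflection ((w * cs.longest K)⁻¹ * t * (w * cs.longest K)) := by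
      simpa using ht.conj (w * cs.longest K)⁻¹
    have h5 := cs.mem_closure_of_length_mul_left_lt hK (cs.longest_mem K) hr h3
    have h6 := mul_mem (mul_mem (cs.longest_mem K) h5) (inv_mem (cs.longest_mem K))
    have e : cs.longest K * ((w * cs.longest K)⁻¹ * t * (w * cs.longest K)) *
      (cs.longest K)⁻¹ = w⁻¹ * t * w := by group
    rwa [e] at h6
  refine cs.toWeak_le_of_forall_reflection fun t ht htx => ?_
  by_contra htz
  have htw : cs.length (t * w) < cs.length w := by
    refine cs.length_mul_lt_of_toWeak_le ?_ htx
    conv_rhs => rw [hw]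
    exact cs.toWeak_le_of_mem_minReps hIJ hx (cs.longest_mem _)
  have h3 := cs.mem_closure_inter hI hJ (key I hI h1 t ht htw htz) (key J hJ h2 t ht htw htz)
  have h4 := mul_mem (mul_mem (cs.longest_mem (I ∩ J)) h3) (inv_mem (cs.longest_mem (I ∩ J)))
  have h5 := cs.length_mul_of_mem_minReps hIJ hx h4
  have e : x * (cs.longest (I ∩ J) * (w⁻¹ * t * w) * (cs.longest (I ∩ J))⁻¹) = t * x := by
    rw [hw]; group
  rw [e] at h5
  omega

/-- Two distinct descents r, s make x the join of xr and xs, since {r} ∩ {s} is empty; if s is the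
only descent, xs is the greatest element strictly below x. -/
theorem isJoinIrreducible_toWeak_iff_existsUnique :
    IsJoinIrreducible (cs.toWeak x) ↔
      ∃! s, s ∈ cs.simpleSet ∧ cs.length (x * s) < cs.length x := by
  have hle : ∀ s ∈ cs.simpleSet, cs.length (x * s) < cs.length x →
      cs.toWeak (x * s) ≤ cs.toWeak x := by
    intro s hs hlt
    have h := cs.length_mul_of_mem hs x
    rw [toWeak_le_iff, mul_inv_rev, inv_mul_cancel_right, cs.length_inv, cs.length_of_mem hs]
    omega
  rw [isJoinIrreducible_iff_exists]
  constructor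
  · rintro ⟨z, hz, hxz⟩
    have hx1 : x ≠ 1 := by rintro rfl; exact hxz cs.toWeak_one_le
    obtain ⟨s, hs, hlt⟩ := cs.exists_mul_right_lt subset_rfl (w := x)
      (by rw [closure_simpleSet]; trivial) hx1
    refine ⟨s, ⟨hs, hlt⟩, ?_⟩
    rintro r ⟨hr, hlt'⟩
    by_contra hne
    have key : ∀ q ∈ cs.simpleSet, cs.length (x * q) < cs.length x →
        cs.toWeak (x * cs.longest {q}) ≤ z := by
      intro q hq hlt
      rw [cs.longest_singleton hq]
      refine hz _ (hle q hq hlt) fun h => ?_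
      rw [cs.toWeak_inj.1 h] at hlt
      exact lt_irrefl _ hlt
    have h := cs.mul_longest_inter_toWeak_le (I := {r}) (J := {s}) (by simpa) (by simpa)
      (by simpa) (key r hr hlt') (key s hs hlt)
    rw [Set.singleton_inter_eq_empty.2 (by simpa), longest_empty, mul_one] at h
    exact hxz h
  · rintro ⟨s, ⟨hs, hlt⟩, huniq⟩
    refine ⟨cs.toWeak (x * s), ?_, fun h => ?_⟩
    · intro (y : W) (hy : cs.toWeak y ≤ cs.toWeak x) hne
      obtain ⟨r, hr, hltr⟩ := cs.exists_mul_right_lt subset_rfl (w := y⁻¹ * x)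
        (by rw [closure_simpleSet]; trivial) (by rw [ne_eq, inv_mul_eq_one]; exact hne)
      change cs.toWeak y ≤ _
      rw [toWeak_le_iff] at hy ⊢
      have h1 := cs.length_mul_le y (y⁻¹ * x * r)
      have e : y * (y⁻¹ * x * r) = x * r := by group
      rw [e] at h1
      obtain rfl := huniq r ⟨hr, by omega⟩
      have h2 := cs.length_mul_of_mem hs (y⁻¹ * x)
      have h3 := cs.length_mul_of_mem hs x
      rw [← mul_assoc]
      omega
    · have := cs.length_le_of_toWeak_le h
      omega

/-! ### Join-irreducible cosets -/

theorem exists_descent_of_facialStep (hI : I ⊆ cs.simpleSet) (hx : x ∈ cs.minReps I)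
    {D : cs.Complex} (h : cs.FacialStep D (cs.coset x I hI)) :
    ∃ r, ∃ hr : r ∈ cs.simpleSet,
      cs.length (x * cs.longest I * r) < cs.length (x * cs.longest I) ∧
      ((r ∈ I ∧ D = cs.coset x (I \ {r}) (Set.sdiff_subset.trans hI)) ∨
        (r ∉ I ∧ D = cs.coset (x * cs.longest I * cs.longest (insert r I)) (insert r I)
          (Set.insert_subset hr hI))) := by
  generalize hC : cs.coset x I hI = C at h
  cases h with
  | up I₀ hI₀ x₀ hx₀ s hs hsI hxs =>
    obtain ⟨rfl, rfl⟩ := cs.coset_inj hI _ hx hxs hC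
    refine ⟨s, hs, cs.mul_longest_mul_lt hI hx (Set.mem_insert s I₀),
      Or.inl ⟨Set.mem_insert s I₀, ?_⟩⟩
    congr 1
    rw [Set.insert_sdiff_self_of_notMem hsI]
  | down I₀ hI₀ x₀ hx₀ s hs =>
    have hL := (Set.sdiff_subset (s := I₀) (t := {s})).trans hI₀
    obtain ⟨rfl, rfl⟩ := cs.coset_inj hI hL hx
      (cs.mul_longest_mul_longest_mem_minReps hI₀ hx₀ Set.sdiff_subset) hC
    have e : x₀ * cs.longest I₀ * cs.longest (I₀ \ {s}) * cs.longest (I₀ \ {s}) =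
        x₀ * cs.longest I₀ := by
      rw [mul_assoc _ (cs.longest (I₀ \ {s})), cs.longest_mul_self hL, mul_one]
    have e2 : insert s (I₀ \ {s}) = I₀ := by
      rw [Set.insert_sdiff_singleton, Set.insert_eq_of_mem hs]
    refine ⟨s, hI₀ hs, ?_, Or.inr ⟨by simp, ?_⟩⟩
    · rw [e]
      exact cs.mul_longest_mul_lt hI₀ hx₀ hs
    · simp only [e, e2]
      rw [mul_assoc, cs.longest_mul_self hI₀]
      simp

theorem isJoinIrreducible_coset_iff_existsUnique (hI : I ⊆ cs.simpleSet)
    (hx : x ∈ cs.minReps I) :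
    IsJoinIrreducible (cs.coset x I hI) ↔ ∃! s, s ∈ cs.simpleSet ∧
      cs.length (x * cs.longest I * s) < cs.length (x * cs.longest I) := by
  have hmI : ∀ s ∈ I, cs.length (x * cs.longest I * s) < cs.length (x * cs.longest I) :=
    fun s hs => cs.mul_longest_mul_lt hI hx hs
  have hlx := cs.length_mul_longest hI hx
  have hmm : x * cs.longest I * cs.longest I = x := by
    rw [mul_assoc, cs.longest_mul_self hI, mul_one]
  have hm_ins : ∀ r, cs.length (x * cs.longest I * r) < cs.length (x * cs.longest I) →
      ∀ s ∈ insert r I,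
        cs.length (x * cs.longest I * s) < cs.length (x * cs.longest I) := by
    rintro r hr s (rfl | hs)
    exacts [hr, hmI s hs]
  rw [isJoinIrreducible_iff_exists]
  constructor
  · rintro ⟨Z, hZ, hxZ⟩
    obtain ⟨K, hK, z, hz, rfl⟩ := cs.exists_coset_eq Z
    rw [coset_le_iff _ _ _ hx hz] at hxZ
    -- Bounds from the predecessor with the same minimum.
    have keyA : ∀ r ∈ I, cs.toWeak x ≤ cs.toWeak z ∧
        cs.toWeak (x * cs.longest (I \ {r})) ≤ cs.toWeak (z * cs.longest K) := by
      intro r hr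
      have hL := (Set.sdiff_subset (s := I) (t := {r})).trans hI
      have hxL := cs.minReps_anti (Set.sdiff_subset (s := I) (t := {r})) hx
      rw [← coset_le_iff cs hL hK hxL hz]
      refine hZ _ ((cs.coset_le_iff hL hI hxL hx).2 ⟨le_rfl,
        cs.mul_toWeak_le_mul_longest hI hx
          (Subgroup.closure_mono Set.sdiff_subset (cs.longest_mem _))⟩) fun h => ?_
      have h1 := (cs.coset_inj hL hI hxL hx h).2
      rw [← h1] at hr
      simp at hr
    -- Bounds from the predecessor with the same maximum.
    have keyB : ∀ r ∈ cs.simpleSet, r ∉ I →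
        cs.length (x * cs.longest I * r) < cs.length (x * cs.longest I) →
        cs.toWeak (x * cs.longest I * cs.longest (insert r I)) ≤ cs.toWeak z ∧
        cs.toWeak (x * cs.longest I) ≤ cs.toWeak (z * cs.longest K) := by
      intro r hr hrI hlt
      have hJ := Set.insert_subset hr hI
      have hy := cs.mul_longest_mem_minReps hJ (hm_ins r hlt)
      have e : x * cs.longest I * cs.longest (insert r I) * cs.longest (insert r I) =
          x * cs.longest I := by
        rw [mul_assoc _ (cs.longest (insert r I)), cs.longest_mul_self hJ, mul_one]
      have h0 := cs.coset_le_iff hJ hK hy hz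
      rw [e] at h0
      rw [← h0]
      refine hZ _ ((cs.coset_le_iff hJ hI hy hx).2 ⟨?_, by rw [e]⟩) fun h => ?_
      · have h1 := cs.toWeak_le_of_mem_minReps hJ hy (mul_mem (cs.longest_mem (insert r I))
          (Subgroup.closure_mono (Set.subset_insert r I) (cs.longest_mem I)))
        rwa [← mul_assoc, e, hmm] at h1
      · have h1 := (cs.coset_inj hJ hI hy hx h).2
        rw [← h1] at hrI
        simp at hrI
    have hm1 : x * cs.longest I ≠ 1 := by
      intro h
      rw [h, cs.length_one] at hlx
      obtain rfl : x = 1 := cs.length_eq_zero_iff.1 (by omega)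
      rw [h] at hxZ
      exact hxZ ⟨cs.toWeak_one_le, cs.toWeak_one_le⟩
    obtain ⟨s, hs, hlt⟩ := cs.exists_mul_right_lt subset_rfl (w := x * cs.longest I)
      (by rw [closure_simpleSet]; trivial) hm1
    refine ⟨s, ⟨hs, hlt⟩, ?_⟩
    rintro r ⟨hr, hlt'⟩
    by_contra hne
    apply hxZ
    -- One descent on each side of I bounds minimum and maximum at once. With both in I, every xq
    -- lies in one of the two faces, so their maxima bound x w_I. With both outside, (I ∪ {s}) ∩ (I
    -- ∪ {r}) = I bounds x.
    by_cases hsI : s ∈ I <;> by_cases hrI : r ∈ I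
    · obtain ⟨h1, h2⟩ := keyA s hsI
      obtain ⟨-, h3⟩ := keyA r hrI
      refine ⟨h1, cs.mul_longest_toWeak_le hI hx
        (h1.trans (cs.toWeak_le_of_mem_minReps hK hz (cs.longest_mem K))) fun q hq => ?_⟩
      have hstep : ∀ p, q ≠ p →
          cs.toWeak (x * q) ≤ cs.toWeak (x * cs.longest (I \ {p})) := fun p hp =>
        cs.mul_toWeak_le_mul_longest (Set.sdiff_subset.trans hI)
          (cs.minReps_anti Set.sdiff_subset hx) (Subgroup.subset_closure ⟨hq, hp⟩)
      by_cases hqs : q = s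
      · exact (hstep r (by rintro rfl; exact hne hqs)).trans h3
      · exact (hstep s hqs).trans h2
    · exact ⟨(keyA s hsI).1, (keyB r hr hrI hlt').2⟩
    · exact ⟨(keyA r hrI).1, (keyB s hs hsI hlt).2⟩
    · refine ⟨?_, (keyB s hs hsI hlt).2⟩
      have h := cs.mul_longest_inter_toWeak_le (Set.insert_subset hs hI)
        (Set.insert_subset hr hI) (hm_ins s hlt) (keyB s hs hsI hlt).1
        (keyB r hr hrI hlt').1
      have e : insert s I ∩ insert r I = I := by
        ext q
        simp only [Set.mem_inter_iff, Set.mem_insert_iff]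
        constructor
        · rintro ⟨rfl | hq, rfl | hq'⟩
          exacts [absurd rfl hne, hq', hq, hq]
        · exact fun hq => ⟨Or.inr hq, Or.inr hq⟩
      rwa [e, hmm] at h
  · rintro ⟨r, ⟨hr, hlt⟩, huniq⟩
    -- The last step of any chain into the coset passes through the predecessor of the unique
    -- descent.
    have key : ∀ C ≤ cs.coset x I hI, C ≠ cs.coset x I hI → ∃ D, C ≤ D ∧
        ((r ∈ I ∧ D = cs.coset x (I \ {r}) (Set.sdiff_subset.trans hI)) ∨
        (r ∉ I ∧ D = cs.coset (x * cs.longest I * cs.longest (insert r I)) (insert r I)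
          (Set.insert_subset hr hI))) := by
      intro C hC hne
      rcases Relation.ReflTransGen.cases_tail hC with h | ⟨D, hCD, hD⟩
      · exact absurd h.symm hne
      · obtain ⟨q, hq, hq1, hq2⟩ := cs.exists_descent_of_facialStep hI hx hD
        obtain rfl := huniq q ⟨hq, hq1⟩
        exact ⟨D, hCD, hq2⟩
    by_cases hrI : r ∈ I
    · refine ⟨cs.coset x (I \ {r}) (Set.sdiff_subset.trans hI), fun C hC hne => ?_, fun h => ?_⟩
      · obtain ⟨D, hCD, ⟨-, rfl⟩ | ⟨h, -⟩⟩ := key C hC hne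
        exacts [hCD, absurd hrI h]
      · have hxL := cs.minReps_anti (Set.sdiff_subset (s := I) (t := {r})) hx
        have h1 := cs.length_le_of_toWeak_le ((cs.coset_le_iff _ _ hx hxL).1 h).2
        have h2 := cs.length_longest_sdiff_lt hI hrI
        rw [cs.length_mul_longest (Set.sdiff_subset.trans hI) hxL] at h1
        omega
    · refine ⟨cs.coset (x * cs.longest I * cs.longest (insert r I)) (insert r I)
          (Set.insert_subset hr hI), fun C hC hne => ?_, fun h => ?_⟩
      · obtain ⟨D, hCD, ⟨h, -⟩ | ⟨-, rfl⟩⟩ := key C hC hne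
        exacts [absurd h hrI, hCD]
      · have hJ := Set.insert_subset hr hI
        have hy := cs.mul_longest_mem_minReps hJ (hm_ins r hlt)
        have h1 := cs.length_le_of_toWeak_le ((cs.coset_le_iff _ _ hx hy).1 h).1
        have h2 := cs.length_longest_lt_insert hI hr hrI
        have h3 := cs.length_mul_longest_of_forall_lt hJ (hm_ins r hlt)
        omega

/-! ### Duality -/

theorem length_longest_simpleSet_mul (w : W) :
    cs.length w + cs.length (cs.longest cs.simpleSet * w) =
      cs.length (cs.longest cs.simpleSet) :=
  cs.length_longest_mul subset_rfl (by rw [closure_simpleSet]; trivial)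

theorem longest_simpleSet_mul_cancel (w : W) :
    cs.longest cs.simpleSet * (cs.longest cs.simpleSet * w) = w := by
  rw [← mul_assoc, cs.longest_mul_self subset_rfl, one_mul]

theorem longest_simpleSet_mul_toWeak_le :
    cs.toWeak (cs.longest cs.simpleSet * v) ≤ cs.toWeak (cs.longest cs.simpleSet * u) ↔
      cs.toWeak u ≤ cs.toWeak v := by
  have h1 := cs.length_longest_simpleSet_mul u
  have h2 := cs.length_longest_simpleSet_mul v
  have e : (cs.longest cs.simpleSet * v)⁻¹ * (cs.longest cs.simpleSet * u) = (u⁻¹ * v)⁻¹ := by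
    group
  rw [toWeak_le_iff, toWeak_le_iff, e, cs.length_inv]
  omega

/-- Left multiplication by the longest element, as an anti-automorphism of the weak order. -/
noncomputable def weakDual : cs.WeakOrder ≃o cs.WeakOrderᵒᵈ where
  toFun (w : W) := OrderDual.toDual (cs.toWeak (cs.longest cs.simpleSet * w))
  invFun (w : W) := cs.toWeak (cs.longest cs.simpleSet * w)
  left_inv := cs.longest_simpleSet_mul_cancel
  right_inv := cs.longest_simpleSet_mul_cancel
  map_rel_iff' := cs.longest_simpleSet_mul_toWeak_le

theorem longest_simpleSet_mul_mem_minReps (hI : I ⊆ cs.simpleSet) (hx : x ∈ cs.minReps I) :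
    cs.longest cs.simpleSet * x * cs.longest I ∈ cs.minReps I := by
  refine cs.mul_longest_mem_minReps hI fun s hs => ?_
  have h1 := cs.length_longest_simpleSet_mul x
  have h2 := cs.length_longest_simpleSet_mul (x * s)
  have h3 := hx s hs
  rw [mul_assoc]
  omega

theorem mulComplex_longest_coset (hI : I ⊆ cs.simpleSet) :
    cs.mulComplex (cs.longest cs.simpleSet) (cs.coset x I hI) =
      cs.coset (cs.longest cs.simpleSet * x * cs.longest I) I hI := by
  rw [mulComplex_coset, cs.coset_mul_of_mem hI (cs.longest_mem I)]

/-- Left multiplication by the longest element reverses the weak order, so it swaps the minimum and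
maximum conditions of `coset_le_iff` as well as C and D. -/
theorem mulComplex_longest_le {C D : cs.Complex} :
    cs.mulComplex (cs.longest cs.simpleSet) D ≤ cs.mulComplex (cs.longest cs.simpleSet) C ↔
      C ≤ D := by
  obtain ⟨I, hI, x, hx, rfl⟩ := cs.exists_coset_eq C
  obtain ⟨J, hJ, y, hy, rfl⟩ := cs.exists_coset_eq D
  have e : ∀ K ⊆ cs.simpleSet, ∀ w, cs.longest cs.simpleSet * w * cs.longest K *
      cs.longest K = cs.longest cs.simpleSet * w := by
    intro K hK w
    rw [mul_assoc _ (cs.longest K), cs.longest_mul_self hK, mul_one]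
  rw [mulComplex_longest_coset, mulComplex_longest_coset, coset_le_iff _ _ _ hx hy,
    coset_le_iff _ _ _ (cs.longest_simpleSet_mul_mem_minReps hJ hy)
      (cs.longest_simpleSet_mul_mem_minReps hI hx), e I hI, e J hJ, mul_assoc, mul_assoc,
    longest_simpleSet_mul_toWeak_le, longest_simpleSet_mul_toWeak_le, and_comm]

theorem mulComplex_longest_involutive :
    Function.Involutive (cs.mulComplex (cs.longest cs.simpleSet)) := by
  intro C
  refine Subtype.ext ?_
  change cs.longest cs.simpleSet • cs.longest cs.simpleSet • C.1 = C.1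
  rw [smul_smul, cs.longest_mul_self subset_rfl, one_smul]

/-- Left multiplication by the longest element, as an anti-automorphism of the facial weak
order. -/
noncomputable def complexDual : cs.Complex ≃o cs.Complexᵒᵈ where
  toFun C := OrderDual.toDual (cs.mulComplex (cs.longest cs.simpleSet) C)
  invFun C := cs.mulComplex (cs.longest cs.simpleSet) (OrderDual.ofDual C)
  left_inv C := cs.mulComplex_longest_involutive C
  right_inv C := cs.mulComplex_longest_involutive (OrderDual.ofDual C)
  map_rel_iff' := cs.mulComplex_longest_le

theorem longest_simpleSet_mul_lt_iff :
    cs.length (cs.longest cs.simpleSet * x * s) < cs.length (cs.longest cs.simpleSet * x) ↔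
      cs.length x < cs.length (x * s) := by
  have h1 := cs.length_longest_simpleSet_mul x
  have h2 := cs.length_longest_simpleSet_mul (x * s)
  rw [mul_assoc]
  omega

theorem isMeetIrreducible_toWeak_iff_existsUnique :
    IsMeetIrreducible (cs.toWeak x) ↔
      ∃! s, s ∈ cs.simpleSet ∧ cs.length x < cs.length (x * s) := by
  simp_rw [← cs.longest_simpleSet_mul_lt_iff (x := x)]
  rw [← isJoinIrreducible_toWeak_iff_existsUnique]
  exact isMeetIrreducible_iff_of_orderIso cs.weakDual (cs.toWeak x)

/-- The dual coset has maximum w₀x, with w₀ the longest element of W, and its descents are the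
ascents of x; this is why only x enters. -/
theorem isMeetIrreducible_coset_iff_existsUnique (hI : I ⊆ cs.simpleSet)
    (hx : x ∈ cs.minReps I) :
    IsMeetIrreducible (cs.coset x I hI) ↔
      ∃! s, s ∈ cs.simpleSet ∧ cs.length x < cs.length (x * s) := by
  have h := cs.isJoinIrreducible_coset_iff_existsUnique hI
    (cs.longest_simpleSet_mul_mem_minReps hI hx)
  rw [mul_assoc _ (cs.longest I), cs.longest_mul_self hI, mul_one] at h
  simp_rw [longest_simpleSet_mul_lt_iff] at h
  rw [← h, ← mulComplex_longest_coset]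
  exact isMeetIrreducible_iff_of_orderIso cs.complexDual _

end Finite

end CoxeterSystem

theorem proposition3p12 {B W : Type*} [Group W] [Finite W] {M : CoxeterMatrix B}
    (cs : CoxeterSystem M W) (I : Set W) (hI : I ⊆ cs.simpleSet)
    (x : W) (hx : x ∈ cs.minReps I) :
    (IsJoinIrreducible (cs.coset x I hI) ↔
      (I = ∅ ∧ IsJoinIrreducible (cs.toWeak x)) ∨
        ∃ s ∈ cs.simpleSet, I = {s} ∧ IsJoinIrreducible (cs.toWeak (x * s))) ∧
    (IsMeetIrreducible (cs.coset x I hI) ↔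
      (I = ∅ ∧ IsMeetIrreducible (cs.toWeak x)) ∨
        ∃ s ∈ cs.simpleSet, I = {s} ∧ IsMeetIrreducible (cs.toWeak x)) := by
  -- Used with P the descents of the maximum, then the ascents of the minimum; both contain I.
  have hsub : ∀ {P : W → Prop}, (∀ s ∈ I, P s) → (∃! s, s ∈ cs.simpleSet ∧ P s) →
      I = ∅ ∨ ∃ s ∈ cs.simpleSet, I = {s} := by
    rintro P hP ⟨s, ⟨hs, -⟩, huniq⟩
    rcases Set.subset_singleton_iff_eq.1 (fun r hr => huniq r ⟨hI hr, hP r hr⟩ : I ⊆ {s})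
      with h | h
    exacts [Or.inl h, Or.inr ⟨s, hs, h⟩]
  constructor
  · rw [cs.isJoinIrreducible_coset_iff_existsUnique hI hx]
    simp_rw [cs.isJoinIrreducible_toWeak_iff_existsUnique]
    constructor
    · intro h
      rcases hsub (fun s hs => cs.mul_longest_mul_lt hI hx hs) h with rfl | ⟨s, hs, rfl⟩
      · rw [cs.longest_empty, mul_one] at h
        exact Or.inl ⟨rfl, h⟩
      · rw [cs.longest_singleton hs] at h
        exact Or.inr ⟨s, hs, rfl, h⟩
    · rintro (⟨rfl, h⟩ | ⟨s, hs, rfl, h⟩)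
      · rwa [cs.longest_empty, mul_one]
      · rwa [cs.longest_singleton hs]
  · rw [cs.isMeetIrreducible_coset_iff_existsUnique hI hx,
      cs.isMeetIrreducible_toWeak_iff_existsUnique]
    constructor
    · intro h
      rcases hsub hx h with hI' | ⟨s, hs, hI'⟩
      exacts [Or.inl ⟨hI', h⟩, Or.inr ⟨s, hs, hI', h⟩]
    · rintro (⟨-, h⟩ | ⟨s, hs, -, h⟩) <;> exact h
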